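/- **Setting.** Fix positive integers $p,T$, integers $q,r\ge 0$ and constants $L,M>0$, $M_\Phi\ge 0$; all norms are Euclidean (operator norm for matrices). Let $h:\mathbb R^p\times\mathbb R^r\to\mathbb R^q$ be a steady-state input-output map, $d\in\mathbb R^r$ a fixed disturbance and $\Phi:\mathbb R^p\times\mathbb R^q\to\mathbb R$ a differentiable, possibly nonconvex objective. Assume that $u\mapsto h(u,d)$ is differentiable, that the reduced objective $\tilde\Phi(u)=\Phi(u,h(u,d))$ is $M$-Lipschitz with $L$-Lipschitz gradient and $\tilde\Phi^*=\inf_u\tilde\Phi(u)>-\infty$, and that $\Phi(u,y)$ is $M_\Phi$-Lipschitz in $y$. Given $w_0,u_{-1}\in\mathbb R^p$, a step size $\eta$, a smoothing parameter $\delta$, and coefficients $\alpha_k\in[0,1]$, the gray-box controller iterates, for $k\ge 0$, $$u_k=w_k+\delta v_k,\qquad y_k=h(u_k,d),\qquad w_{k+1}=w_k-\eta\tilde\phi_k,$$ $$\tilde\phi_k=\alpha_k\big(\nabla_u\Phi(u_k,y_k)+\hat H_k^\top\nabla_y\Phi(u_k,y_k)\big)+(1-\alpha_k)\,\frac{p\,v_k}{\delta}\big(\Phi(u_k,y_k)-\Phi(u_{k-1},y_{k-1})\big),$$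 with $y_{-1}=h(u_{-1},d)$. There is a filtration $(\mathcal F_k)_{k\ge0}$ such that each $v_k$ is uniformly distributed on the unit sphere of $\mathbb R^p$ and $\mathcal F_k$-measurable, $v_{k+1}$ is independent of $\mathcal F_k$, and the approximate sensitivity $\hat H_k\in\mathbb R^{q\times p}$ is $\mathcal F_k$-measurable (for instance, $v_0,v_1,\dots$ are i.i.d. and $\hat H_k$ is a function of $v_0,\dots,v_k$). Let $\epsilon_{H,k}=\|\hat H_k-\nabla_uh(u_k,d)\|$ and $\bar\eta=\dfrac{1}{224\,L\,p^2\,T^{1/3}}$, and take $\delta=\dfrac{\sqrt2\,M}{112\,L\,T^{1/3}}$. **Theorem.** (a) There is a function $C(\cdot,\cdot)>0$, independent of all other data (in particular of $p$ and $T$), such that, whenever $0<\eta\le\bar\eta$ and $\mathbb E[\epsilon_{H,k}^2]<\infty$ for all $k$, $$\frac1T\sum_{k=0}^{T-1}\mathbb E\|\nabla\tilde\Phi(w_k)\|^2\le\frac{4(\mathbb E[\tilde\Phi(w_0)]-\tilde\Phi^*)}{\eta T}+R,$$ $$R=\frac{5M_\Phi^2}{T}\sum_{k=0}^{T-1}\alpha_k\mathbb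 E[\epsilon_{H,k}^2]+\frac{M^2}{112^2T^{5/3}}\sum_{k=0}^{T-1}\big(8\alpha_k+p^2(1-\alpha_k)\big)+\frac{C(M,\mathbb E\|\tilde\phi_0\|^2)}{T}.$$ In particular, for $\eta=\bar\eta$, $$\frac1T\sum_{k=0}^{T-1}\mathbb E\|\nabla\tilde\Phi(w_k)\|^2\le 896L\big(\mathbb E[\tilde\Phi(w_0)]-\tilde\Phi^*\big)\frac{p^2}{T^{2/3}}+R.$$ All expectations occurring here are finite. (b) Let $\kappa\in(0,1]$ and $\kappa\bar\eta\le\eta\le\bar\eta$ (for instance $\eta=\bar\eta$, $\kappa=1$). Suppose that either 1. almost surely $\epsilon_{H,k}\le\bar\epsilon$ for all $k$, and $\alpha_k=\min\{C/(k+1)^{2/3},1\}$, with constants $\bar\epsilon,C>0$; or 2. almost surely $\epsilon_{H,k}\le\bar\epsilon/(k+1)^{\theta}$ for all $k$, and $\alpha_k=\min\{C/(k+1)^{2/3-2\theta},1\}$, with constants $\bar\epsilon,C>0$ and $\theta\in(0,\tfrac13)$. Then $$\frac1T\sum_{k=0}^{T-1}\mathbb E\|\nabla\tilde\Phi(w_k)\|^2\le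 K\,\frac{p^2}{T^{2/3}},$$ where $K$ depends only on $L,M,M_\Phi,C,\bar\epsilon,\kappa$ (and $\theta$ in case 2) and on upper bounds for $\tilde\Phi(w_0)-\tilde\Phi^*$ and $\|w_0-u_{-1}\|$; in particular $K$ does not depend on $p$, $q$, $r$ or $T$. -/

import Mathlib

open MeasureTheory ProbabilityTheory
open scoped NNReal Gradient

noncomputable section

/-- Euclidean space `ℝⁿ`. -/
abbrev Vec (n : ℕ) : Type := EuclideanSpace ℝ (Fin n)

/-- The data of the steady-state problem `min Φ(u, y)` subject to `y = h(u, d)`: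
the input-output map `h`, the objective `Φ` and the (fixed) disturbance `d`. -/
structure SteadyStateProblem (p q r : ℕ) where
  h : Vec p → Vec r → Vec q
  Φ : Vec p → Vec q → ℝ
  d : Vec r

namespace SteadyStateProblem

variable {p q r : ℕ} (P : SteadyStateProblem p q r)

/-- The steady-state output `y = h(u, d)`. -/
def output (u : Vec p) : Vec q := P.h u P.d

/-- The reduced objective `Φ̃(u) = Φ(u, h(u, d))`. -/
def reduced (u : Vec p) : ℝ := P.Φ u (P.output u)

/-- The infimum of the reduced objective over all inputs. -/
def optimalValue : ℝ := ⨅ u, P.reduced u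

/-- The true input-output sensitivity `∇ᵤ h(u, d)`, a `q × p` matrix seen as a linear map. -/
def sensitivity (u : Vec p) : Vec p →L[ℝ] Vec q := fderiv ℝ P.output u

/-- The partial gradient `∇ᵤ Φ(u, y)`. -/
def gradInput (u : Vec p) (y : Vec q) : Vec p := ∇ (fun u' => P.Φ u' y) u

/-- The partial gradient `∇_y Φ(u, y)`. -/
def gradOutput (u : Vec p) (y : Vec q) : Vec q := ∇ (fun y' => P.Φ u y') y

/-- Standing assumptions: the plant is differentiable in the input, the objective is
differentiable, the reduced objective is `M`-Lipschitz, `L`-smooth and bounded below, and the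
objective is `MΦ`-Lipschitz in the output. -/
structure Regular (L M MΦ : ℝ≥0) : Prop where
  plant_differentiable : Differentiable ℝ P.output
  objective_differentiable : Differentiable ℝ (fun z : Vec p × Vec q => P.Φ z.1 z.2)
  reduced_lipschitz : LipschitzWith M P.reduced
  reduced_smooth : LipschitzWith L (∇ P.reduced)
  reduced_bddBelow : BddBelow (Set.range P.reduced)
  objective_lipschitz_output : ∀ u, LipschitzWith MΦ (P.Φ u)

/-- The inexact model-based gradient `∇ᵤ Φ(u, y) + Ĥᵀ ∇_y Φ(u, y)` at `y = h(u, d)`. -/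
def inexactGradient (H : Vec p →L[ℝ] Vec q) (u : Vec p) : Vec p :=
  P.gradInput u (P.output u) + ContinuousLinearMap.adjoint H (P.gradOutput u (P.output u))

/-- The zeroth-order estimate `(p / δ) (Φ(u, y) - Φ(u⁻, y⁻)) v`, where `u⁻` is the previous input
and `y`, `y⁻` are the measured outputs for `u`, `u⁻`. -/
def gradientEstimate (δ : ℝ) (uPrev u v : Vec p) : Vec p :=
  ((p : ℝ) / δ * (P.Φ u (P.output u) - P.Φ uPrev (P.output uPrev))) • v

end SteadyStateProblem

/-- Parameters of the gray-box controller: step size `η`, smoothing parameter `δ`, combination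
coefficients `α k`, initial candidate `w₀`, and the input `u₋₁` applied before the start. -/
structure GrayBoxController (p : ℕ) where
  η : ℝ
  δ : ℝ
  α : ℕ → ℝ
  w₀ : Vec p
  uInit : Vec p

namespace GrayBoxController

variable {p q r : ℕ} (c : GrayBoxController p) (P : SteadyStateProblem p q r)
  (H : ℕ → Vec p →L[ℝ] Vec q) (v : ℕ → Vec p)

/-- The update direction at time `k` for candidate `w` and previous input `uPrev`; the current
input is `w + δ v k`. -/
def directionAt (k : ℕ) (w uPrev : Vec p) : Vec p :=
  c.α k • P.inexactGradient (H k) (w + c.δ • v k)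
    + (1 - c.α k) • P.gradientEstimate c.δ uPrev (w + c.δ • v k) (v k)

/-- The state `(w k, u (k - 1))` of the closed loop along one realization `v 0, v 1, …` of the
exploration vectors and `H 0, H 1, …` of the approximate sensitivities. -/
def state : ℕ → Vec p × Vec p
  | 0 => (c.w₀, c.uInit)
  | k + 1 =>
    ((state k).1 - c.η • c.directionAt P H v k (state k).1 (state k).2,
      (state k).1 + c.δ • v k)

/-- The candidate solution `w k`. -/
def candidate (k : ℕ) : Vec p := (c.state P H v k).1

/-- The input `u k = w k + δ v k`. -/
def input (k : ℕ) : Vec p := c.candidate P H v k + c.δ • v k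

/-- The update direction `φ̃ k`. -/
def direction (k : ℕ) : Vec p := c.directionAt P H v k (c.state P H v k).1 (c.state P H v k).2

theorem candidate_succ (k : ℕ) :
    c.candidate P H v (k + 1) = c.candidate P H v k - c.η • c.direction P H v k := rfl

theorem direction_succ (k : ℕ) :
    c.direction P H v (k + 1) =
      c.α (k + 1) • P.inexactGradient (H (k + 1)) (c.input P H v (k + 1))
        + (1 - c.α (k + 1)) •
          P.gradientEstimate c.δ (c.input P H v k) (c.input P H v (k + 1)) (v (k + 1)) := rfl

/-- The error `‖Ĥ k - ∇ᵤ h(u k, d)‖` (operator norm) of the approximate sensitivity. -/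
def sensitivityError (k : ℕ) : ℝ := ‖H k - P.sensitivity (c.input P H v k)‖

end GrayBoxController

/-- The uniform distribution on the unit sphere of `ℝᵖ`, as a measure on `ℝᵖ`. -/
def uniformSphere (p : ℕ) : Measure (Vec p) :=
  (ProbabilityTheory.cond (volume : Measure (Vec p)).toSphere Set.univ).map Subtype.val

/-- `v 0, v 1, …` are exploration vectors, drawn uniformly from the unit sphere, each independent
of the past, and the approximate sensitivity `H k` uses only information available at time `k`.
Here `ℱ k` is the information at time `k`; it contains `v 0, …, v k` and possibly further
randomness, so that in particular the `v k` are i.i.d. -/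
structure IsExploration {Ω : Type*} [m : MeasurableSpace Ω] {p q : ℕ} (μ : Measure Ω)
    (ℱ : Filtration ℕ m) (v : Ω → ℕ → Vec p) (H : Ω → ℕ → Vec p →L[ℝ] Vec q) : Prop where
  exploration_adapted : ∀ k, Measurable[ℱ k] (fun ω => v ω k)
  exploration_law : ∀ k, μ.map (fun ω => v ω k) = uniformSphere p
  exploration_indep : ∀ k,
    Indep (MeasurableSpace.comap (fun ω => v ω (k + 1)) inferInstance) (ℱ k) μ
  sensitivity_adapted : ∀ k, Measurable[ℱ k] (fun ω => H ω k)

/-- The largest admissible step size `1 / (224 L p² T^{1/3})`. -/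
def maxStep (L : ℝ≥0) (p T : ℕ) : ℝ := 1 / (224 * L * (p : ℝ) ^ 2 * (T : ℝ) ^ (1 / 3 : ℝ))

/-- The smoothing parameter `√2 M / (112 L T^{1/3})`. -/
def smoothingParameter (L M : ℝ≥0) (T : ℕ) : ℝ :=
  Real.sqrt 2 * M / (112 * L * (T : ℝ) ^ (1 / 3 : ℝ))

/-- The convergence measure `(1 / T) ∑_{k < T} E ‖∇ Φ̃(w k)‖²`. -/
def averageSqGradient {Ω : Type*} [MeasurableSpace Ω] {p q r : ℕ} (μ : Measure Ω)
    (c : GrayBoxController p) (P : SteadyStateProblem p q r)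
    (H : Ω → ℕ → Vec p →L[ℝ] Vec q) (v : Ω → ℕ → Vec p) (T : ℕ) : ℝ :=
  1 / T * ∑ k ∈ Finset.range T, ∫ ω, ‖∇ P.reduced (c.candidate P (H ω) (v ω) k)‖ ^ 2 ∂μ

end

/-! Write `g_k` for the gradient of the reduced objective at `w_k`. By smoothness, a step changes
the objective by at most `-η⟪g_k, φ̃_k⟫ + (L/2) η² ‖φ̃_k‖²`, so the direction must align with `g_k`
and have a controlled second moment.

Alignment (`integral_reduced_succ_le`). With the exact sensitivity the model-based part is the
gradient at `u_k`, by the chain rule; sensitivity error and the shift by `δ v_k` cost `MΦ ε_{H,k}`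
and `Lδ`. This is bounded pointwise, since `Ĥ_k` may depend on `v_k`. The zeroth-order part expands
into a term linear in `v_k`, the term `p⟪g_k, v_k⟫²`, and a Taylor remainder of order `pLδ‖g_k‖`.
Both `w_k` and `u_{k-1}` are determined by the past, so the linear term has mean zero, and rotation
invariance of the sphere turns the quadratic term into `E‖g_k‖²`. Young's inequality is tuned so
that both parts leave the same multiple 7/20 of `E‖g_k‖²`.

Second moment (`integral_norm_direction_succ_sq_le`). The residual difference is at most `M‖w_k -
w_{k-1}‖ = Mη‖φ̃_{k-1}‖` plus Taylor terms governed by the two latest gradients. The step size makes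
the first contribution a contraction with factor 1/4. Summed, the second moments are at most a
multiple of `p² ∑ E‖g_k‖²` plus errors, and `Lη p² ≤ 1/224` lets `sum_sq_gradient_le_of_descent`
absorb them into the descent.

For the rates, the coefficients keep `α_k ε_{H,k}²` of order `(k+1)^(-2/3)`, whose sum is of order
`T^(1/3)`. -/

/-! ### Taylor and Lipschitz inequalities for smooth functions. -/

/-- The quadratic bound on the first-order Taylor remainder of a smooth function. -/
theorem abs_sub_sub_inner_gradient_le {E : Type*} [NormedAddCommGroup E] [InnerProductSpace ℝ E]
    [CompleteSpace E] {f : E → ℝ} {L : ℝ≥0} (hf : Differentiable ℝ f)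
    (hL : LipschitzWith L (∇ f)) (x y : E) :
    |f (x + y) - f x - inner ℝ (∇ f x) y| ≤ L / 2 * ‖y‖ ^ 2 := by
  have hder : ∀ t : ℝ, HasDerivAt (fun t : ℝ => f (x + t • y) - f x - t * inner ℝ (∇ f x) y)
      (inner ℝ (∇ f (x + t • y)) y - inner ℝ (∇ f x) y) t := by
    intro t
    have h1 : HasDerivAt (fun t : ℝ => x + t • y) y t := by
      simpa using ((hasDerivAt_id t).smul_const y).const_add x
    have h2 := ((hf (x + t • y)).hasFDerivAt).comp_hasDerivAt t h1
    rw [← inner_gradient_left] at h2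
    exact ((h2.sub_const (f x)).sub ((hasDerivAt_id t).mul_const (inner ℝ (∇ f x) y))).congr_deriv
      (by rw [one_mul])
  have hB : ∀ t : ℝ, HasDerivAt (fun t : ℝ => L / 2 * ‖y‖ ^ 2 * t ^ 2) (L * ‖y‖ ^ 2 * t) t := by
    intro t
    refine ((hasDerivAt_pow 2 t).const_mul ((L : ℝ) / 2 * ‖y‖ ^ 2)).congr_deriv ?_
    norm_num
    ring
  -- The remainder along the segment vanishes at `t = 0` and its derivative is at most `L‖y‖² t`,
  -- the derivative of the barrier `(L/2)‖y‖² t²`.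
  have key := image_norm_le_of_norm_deriv_right_le_deriv_boundary (a := 0) (b := 1)
    (f := fun t : ℝ => f (x + t • y) - f x - t * inner ℝ (∇ f x) y)
    (f' := fun t : ℝ => inner ℝ (∇ f (x + t • y)) y - inner ℝ (∇ f x) y)
    (fun t _ => (hder t).continuousAt.continuousWithinAt)
    (fun t _ => (hder t).hasDerivWithinAt) (by simp) hB ?_ (x := 1) (by simp)
  · simpa using key
  · intro t ht
    rw [← inner_sub_left]
    refine (norm_inner_le_norm _ _).trans ?_
    have := hL.dist_le_mul (x + t • y) x
    rw [dist_eq_norm, dist_eq_norm, add_sub_cancel_left, norm_smul, Real.norm_eq_abs,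
      abs_of_nonneg ht.1] at this
    calc _ ≤ L * (t * ‖y‖) * ‖y‖ := by gcongr
      _ = _ := by ring

/-- The gradient of a Lipschitz function is bounded by the Lipschitz constant. -/
theorem LipschitzWith.norm_gradient_le {E : Type*} [NormedAddCommGroup E] [InnerProductSpace ℝ E]
    [CompleteSpace E] {f : E → ℝ} {M : ℝ≥0} (hM : LipschitzWith M f) (x : E) : ‖∇ f x‖ ≤ M := by
  simpa [gradient] using norm_fderiv_le_of_lipschitz ℝ hM (x₀ := x)

/-! ### First and second moments of the uniform distribution on the sphere. -/

section Sphere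

open scoped Pointwise

variable {p : ℕ}

theorem uniformSphere_apply {B : Set (Vec p)} (hB : MeasurableSet B) :
    uniformSphere p B = ((volume : Measure (Vec p)).toSphere Set.univ)⁻¹ *
      (p * volume (Set.Ioo (0 : ℝ) 1 • (B ∩ Metric.sphere (0 : Vec p) 1))) := by
  rw [uniformSphere, Measure.map_apply measurable_subtype_coe hB,
    ProbabilityTheory.cond_apply MeasurableSet.univ, Set.univ_inter,
    Measure.toSphere_apply' _ (measurable_subtype_coe hB), Subtype.image_preimage_coe,
    Set.inter_comm]
  simp

theorem isProbabilityMeasure_uniformSphere (hp : 0 < p) :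
    IsProbabilityMeasure (uniformSphere p) := by
  have : Nonempty (Fin p) := ⟨⟨0, hp⟩⟩
  have : Nontrivial (Vec p) := inferInstance
  have : IsProbabilityMeasure
      (ProbabilityTheory.cond (volume : Measure (Vec p)).toSphere Set.univ) :=
    cond_isProbabilityMeasure (by
      rw [Ne, Measure.measure_univ_eq_zero]; exact Measure.toSphere_ne_zero _)
  exact Measure.isProbabilityMeasure_map measurable_subtype_coe.aemeasurable

theorem ae_uniformSphere_norm_eq_one : ∀ᵐ v ∂uniformSphere p, ‖v‖ = 1 := by
  rw [uniformSphere, ae_map_iff measurable_subtype_coe.aemeasurable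
    (measurableSet_eq_fun measurable_norm measurable_const)]
  filter_upwards with x
  simp

/-- The mass of a set is proportional to the volume of the cone over it; a linear isometry commutes
with forming cones and preserves volume. -/
theorem uniformSphere_map_isometry (e : Vec p ≃ₗᵢ[ℝ] Vec p) :
    (uniformSphere p).map e = uniformSphere p := by
  ext B hB
  have he : Measurable e := e.continuous.measurable
  rw [Measure.map_apply he hB, uniformSphere_apply hB, uniformSphere_apply (he hB)]
  congr 2
  have : Set.Ioo (0 : ℝ) 1 • (e ⁻¹' B ∩ Metric.sphere (0 : Vec p) 1) =
      e ⁻¹' (Set.Ioo (0 : ℝ) 1 • (B ∩ Metric.sphere (0 : Vec p) 1)) := by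
    ext x
    simp only [Set.mem_smul, Set.mem_preimage, Set.mem_inter_iff]
    constructor
    · rintro ⟨t, ht, y, ⟨hy, hy'⟩, rfl⟩
      exact ⟨t, ht, e y, ⟨hy, by simpa using hy'⟩, by simp⟩
    · rintro ⟨t, ht, y, ⟨hy, hy'⟩, hx⟩
      exact ⟨t, ht, e.symm y, ⟨by simpa using hy, by simpa using hy'⟩, by
        apply e.injective; simpa using hx⟩
  rw [this]
  exact e.measurePreserving.measure_preimage_equiv (f := e.toMeasurableEquiv) _

theorem integral_uniformSphere_comp_isometry (e : Vec p ≃ₗᵢ[ℝ] Vec p) (g : Vec p → ℝ) :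
    ∫ v, g (e v) ∂uniformSphere p = ∫ v, g v ∂uniformSphere p := by
  conv_rhs => rw [← uniformSphere_map_isometry e]
  exact (integral_map_equiv e.toMeasurableEquiv g).symm

theorem integral_uniformSphere_inner (a : Vec p) :
    ∫ v, inner ℝ a v ∂uniformSphere p = 0 := by
  have h := integral_uniformSphere_comp_isometry (LinearIsometryEquiv.neg ℝ)
    (fun v : Vec p => inner ℝ a v)
  simp only [LinearIsometryEquiv.coe_neg, inner_neg_right, integral_neg] at h
  linarith

/-- The reflection in the hyperplane orthogonal to `a - b` carries `a` to `b` and preserves the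
measure. -/
theorem integral_uniformSphere_inner_sq_congr {a b : Vec p} (hab : ‖a‖ = ‖b‖) :
    ∫ v, inner ℝ a v ^ 2 ∂uniformSphere p = ∫ v, inner ℝ b v ^ 2 ∂uniformSphere p := by
  set R := (Submodule.span ℝ {a - b})ᗮ.reflection
  have hR : R a = b := Submodule.reflection_sub hab
  rw [← integral_uniformSphere_comp_isometry R (fun v => inner ℝ b v ^ 2)]
  congr 1
  ext v
  rw [← hR, LinearIsometryEquiv.inner_map_map]

theorem integral_uniformSphere_inner_sq (hp : 0 < p) (a : Vec p) :
    ∫ v, inner ℝ a v ^ 2 ∂uniformSphere p = ‖a‖ ^ 2 / p := by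
  have := isProbabilityMeasure_uniformSphere hp
  have hint : ∀ b : Vec p, Integrable (fun v => inner ℝ b v ^ 2) (uniformSphere p) := by
    intro b
    refine Integrable.of_bound (C := ‖b‖ ^ 2)
      (Continuous.aestronglyMeasurable (by fun_prop)) ?_
    filter_upwards [ae_uniformSphere_norm_eq_one] with v hv
    have := norm_inner_le_norm (𝕜 := ℝ) b v
    rw [hv, mul_one] at this
    rw [norm_pow]
    gcongr
  -- The `p` vectors `‖a‖ eᵢ` have the same norm as `a`, hence equal integrals, and on the sphere
  -- the integrands add up to `‖a‖² ‖v‖² = ‖a‖²`.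
  have hsum : ∑ i : Fin p, ∫ v, inner ℝ (EuclideanSpace.single i (‖a‖ : ℝ)) v ^ 2 ∂uniformSphere p
      = ‖a‖ ^ 2 := by
    rw [← integral_finsetSum _ fun i _ => hint _]
    have : (fun v : Vec p => ∑ i : Fin p, inner ℝ (EuclideanSpace.single i (‖a‖ : ℝ)) v ^ 2)
        =ᵐ[uniformSphere p] fun _ => ‖a‖ ^ 2 := by
      filter_upwards [ae_uniformSphere_norm_eq_one] with v hv
      simp only [EuclideanSpace.inner_single_left, mul_pow, ← Finset.mul_sum]
      have h2 := EuclideanSpace.norm_sq_eq v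
      simp only [hv, Real.norm_eq_abs, sq_abs] at h2
      simp [← h2]
    rw [integral_congr_ae this]
    simp
  rw [Finset.sum_congr rfl fun i _ => integral_uniformSphere_inner_sq_congr
    (show ‖EuclideanSpace.single i (‖a‖ : ℝ)‖ = ‖a‖ by simp)] at hsum
  have hp' : (p : ℝ) ≠ 0 := by positivity
  rw [Finset.sum_const, Finset.card_univ, Fintype.card_fin, nsmul_eq_mul] at hsum
  field_simp
  linarith

end Sphere

/-! ### Averaging over a sphere vector independent of the past. -/

section Independence

variable {Ω : Type*} {p : ℕ} {m' : MeasurableSpace Ω} [m : MeasurableSpace Ω]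
  {μ : Measure Ω} {W v : Ω → Vec p}

theorem ae_norm_eq_one_of_map_eq_uniformSphere
    (hv : Measurable v) (hlaw : μ.map v = uniformSphere p) : ∀ᵐ ω ∂μ, ‖v ω‖ = 1 := by
  have h := ae_uniformSphere_norm_eq_one (p := p)
  rw [← hlaw] at h
  exact ae_of_ae_map hv.aemeasurable h

theorem integrable_inner_of_map_eq_uniformSphere
    (hm : m' ≤ m) (hv : Measurable v) (hlaw : μ.map v = uniformSphere p) (hW : Measurable[m'] W) (hWi : Integrable W μ) :
    Integrable (fun ω => inner ℝ (W ω) (v ω)) μ := by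
  have hW' : Measurable W := hW.mono hm le_rfl
  refine hWi.norm.mono' (hW'.inner hv).aestronglyMeasurable ?_
  filter_upwards [ae_norm_eq_one_of_map_eq_uniformSphere hv hlaw] with ω hω
  simpa [hω] using norm_inner_le_norm (𝕜 := ℝ) (W ω) (v ω)

theorem integrable_inner_sq_of_map_eq_uniformSphere
    (hm : m' ≤ m) (hv : Measurable v) (hlaw : μ.map v = uniformSphere p) (hW : Measurable[m'] W) (hWi : Integrable (fun ω => ‖W ω‖ ^ 2) μ) :
    Integrable (fun ω => inner ℝ (W ω) (v ω) ^ 2) μ := by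
  have hW' : Measurable W := hW.mono hm le_rfl
  refine hWi.mono' ((hW'.inner hv).pow_const 2).aestronglyMeasurable ?_
  filter_upwards [ae_norm_eq_one_of_map_eq_uniformSphere hv hlaw] with ω hω
  have := norm_inner_le_norm (𝕜 := ℝ) (W ω) (v ω)
  rw [hω, mul_one] at this
  rw [norm_pow]
  gcongr

variable [IsProbabilityMeasure μ]

/-- Integrating out a random vector that is independent of the past. -/
theorem integral_comp_eq_of_indep (hm : m' ≤ m) (hv : Measurable v)
    (hlaw : μ.map v = uniformSphere p)
    (hind : Indep (MeasurableSpace.comap v inferInstance) m' μ) (hW : Measurable[m'] W)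
    {F : Vec p → Vec p → ℝ} (hF : Continuous fun z : Vec p × Vec p => F z.1 z.2)
    (hint : Integrable (fun ω => F (W ω) (v ω)) μ) {G : Vec p → ℝ}
    (hG : ∀ w, ∫ x, F w x ∂uniformSphere p = G w) :
    ∫ ω, F (W ω) (v ω) ∂μ = ∫ ω, G (W ω) ∂μ := by
  have hW' : Measurable W := hW.mono hm le_rfl
  have hindep : IndepFun W v μ := by
    rw [IndepFun_iff_Indep]
    exact (indep_of_indep_of_le_right hind hW.comap_le).symm
  have hprod := (indepFun_iff_map_prod_eq_prod_map_map hW'.aemeasurable hv.aemeasurable).1 hindep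
  have hp : IsProbabilityMeasure (μ.map W) := Measure.isProbabilityMeasure_map hW'.aemeasurable
  have hp' : IsProbabilityMeasure (uniformSphere p) := by
    rw [← hlaw]; exact Measure.isProbabilityMeasure_map hv.aemeasurable
  have hpair : Measurable fun ω => (W ω, v ω) := hW'.prodMk hv
  rw [hlaw] at hprod
  have hFint : Integrable (fun z : Vec p × Vec p => F z.1 z.2) ((μ.map W).prod (uniformSphere p)) := by
    rw [← hprod]
    exact (integrable_map_measure hF.aestronglyMeasurable hpair.aemeasurable).2 hint
  have h1 : ∫ ω, F (W ω) (v ω) ∂μ =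
      ∫ z, F z.1 z.2 ∂((μ.map W).prod (uniformSphere p)) := by
    rw [← hprod]
    exact (integral_map hpair.aemeasurable hF.aestronglyMeasurable).symm
  have hGF : (fun w => ∫ x, F w x ∂uniformSphere p) = G := funext hG
  rw [h1, integral_prod _ hFint]
  simp only [hG]
  refine integral_map hW'.aemeasurable ?_
  rw [← hGF]
  exact hFint.aestronglyMeasurable.integral_prod_right'

theorem integral_inner_eq_zero_of_indep
    (hm : m' ≤ m) (hv : Measurable v) (hlaw : μ.map v = uniformSphere p)
    (hind : Indep (MeasurableSpace.comap v inferInstance) m' μ) (hW : Measurable[m'] W) (hWi : Integrable W μ) :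
    ∫ ω, inner ℝ (W ω) (v ω) ∂μ = 0 := by
  rw [integral_comp_eq_of_indep hm hv hlaw hind hW (F := fun w x => inner ℝ w x) (by fun_prop)
    (integrable_inner_of_map_eq_uniformSphere hm hv hlaw hW hWi) (G := fun _ => 0)
    integral_uniformSphere_inner]
  simp

theorem integral_inner_sq_of_indep
    (hm : m' ≤ m) (hv : Measurable v) (hlaw : μ.map v = uniformSphere p)
    (hind : Indep (MeasurableSpace.comap v inferInstance) m' μ) (hW : Measurable[m'] W) (hp : 0 < p) (hWi : Integrable (fun ω => ‖W ω‖ ^ 2) μ) :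
    ∫ ω, p * inner ℝ (W ω) (v ω) ^ 2 ∂μ = ∫ ω, ‖W ω‖ ^ 2 ∂μ := by
  rw [integral_comp_eq_of_indep hm hv hlaw hind hW (F := fun w x => p * inner ℝ w x ^ 2)
    (by fun_prop) ((integrable_inner_sq_of_map_eq_uniformSphere hm hv hlaw hW hWi).const_mul _)
    (G := fun w => ‖w‖ ^ 2)]
  intro w
  have hp' : (p : ℝ) ≠ 0 := by positivity
  rw [integral_const_mul, integral_uniformSphere_inner_sq hp]
  field_simp

end Independence

/-! ### Chain rule, measurability and pathwise estimates for the two gradient surrogates. -/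

namespace SteadyStateProblem.Regular

variable {p q r : ℕ} {P : SteadyStateProblem p q r} {L M MΦ : ℝ≥0}

theorem reduced_differentiable (hP : P.Regular L M MΦ) : Differentiable ℝ P.reduced :=
  hP.objective_differentiable.comp (differentiable_id.prodMk hP.plant_differentiable)

/-- Passing from partial gradients to the joint derivative of `Φ` gives both the chain rule for the
exact sensitivity and joint measurability. -/
theorem inner_inexactGradient (hP : P.Regular L M MΦ) (H : Vec p →L[ℝ] Vec q) (u x : Vec p) :
    inner ℝ (P.inexactGradient H u) x =
      fderiv ℝ (fun z : Vec p × Vec q => P.Φ z.1 z.2) (u, P.output u) (x, H x) := by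
  set y := P.output u
  have hD := (hP.objective_differentiable (u, y)).hasFDerivAt
  have h1 := HasFDerivAt.comp (f := fun u' : Vec p => (u', y)) u hD
    ((hasFDerivAt_id u).prodMk (hasFDerivAt_const y u))
  have h2 := HasFDerivAt.comp (f := fun y' : Vec q => (u, y')) y hD
    ((hasFDerivAt_const u y).prodMk (hasFDerivAt_id y))
  simp only [Function.comp_def] at h1 h2
  rw [inexactGradient, inner_add_left, ContinuousLinearMap.adjoint_inner_left, gradInput,
    gradOutput, inner_gradient_left, inner_gradient_left, h1.fderiv, h2.fderiv]
  simp only [ContinuousLinearMap.comp_apply, ContinuousLinearMap.prod_apply, ← map_add]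
  simp

theorem inexactGradient_sensitivity (hP : P.Regular L M MΦ) (u : Vec p) :
    P.inexactGradient (P.sensitivity u) u = ∇ P.reduced u := by
  refine ext_inner_right ℝ fun x => ?_
  have h := HasFDerivAt.comp (f := fun u' : Vec p => (u', P.output u')) u
    (hP.objective_differentiable (u, P.output u)).hasFDerivAt
    ((hasFDerivAt_id u).prodMk (hP.plant_differentiable u).hasFDerivAt)
  change HasFDerivAt P.reduced _ u at h
  rw [hP.inner_inexactGradient, inner_gradient_left, h.fderiv]
  rfl

theorem norm_gradOutput_le (hP : P.Regular L M MΦ) (u : Vec p) (y : Vec q) :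
    ‖P.gradOutput u y‖ ≤ MΦ :=
  (hP.objective_lipschitz_output u).norm_gradient_le y

theorem norm_inexactGradient_sub_le (hP : P.Regular L M MΦ) (H : Vec p →L[ℝ] Vec q) (u : Vec p) :
    ‖P.inexactGradient H u - ∇ P.reduced u‖ ≤ MΦ * ‖H - P.sensitivity u‖ := by
  rw [← hP.inexactGradient_sensitivity, inexactGradient, inexactGradient, add_sub_add_left_eq_sub,
    ← sub_apply, ← map_sub]
  refine (ContinuousLinearMap.le_opNorm _ _).trans ?_
  rw [LinearIsometryEquiv.norm_map, mul_comm]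
  gcongr
  exact hP.norm_gradOutput_le u _

/-- The objective is only differentiable, so its gradient need not be continuous. Derivatives are
nevertheless measurable, and the surrogate depends continuously on the pair of the joint derivative
and `H`. -/
theorem measurable_inexactGradient (hP : P.Regular L M MΦ) :
    Measurable fun z : (Vec p →L[ℝ] Vec q) × Vec p => P.inexactGradient z.1 z.2 := by
  have hD : Measurable fun u : Vec p =>
      fderiv ℝ (fun z : Vec p × Vec q => P.Φ z.1 z.2) (u, P.output u) :=
    (measurable_fderiv ℝ _).comp
      (measurable_id.prodMk hP.plant_differentiable.continuous.measurable)
  have hpair : Measurable fun z : (Vec p →L[ℝ] Vec q) × Vec p =>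
      (fderiv ℝ (fun z : Vec p × Vec q => P.Φ z.1 z.2) (z.2, P.output z.2), z.1) :=
    (hD.comp measurable_snd).prodMk measurable_fst
  have hcont : Continuous fun z : (Vec p × Vec q →L[ℝ] ℝ) × (Vec p →L[ℝ] Vec q) =>
      (InnerProductSpace.toDual ℝ (Vec p)).symm
        (z.1.comp ((ContinuousLinearMap.inl ℝ _ _) + (ContinuousLinearMap.inr ℝ _ _).comp z.2)) := by
    fun_prop
  convert hcont.measurable.comp hpair using 1
  ext1 z
  refine ext_inner_right ℝ fun x => ?_
  rw [hP.inner_inexactGradient, Function.comp_apply, InnerProductSpace.toDual_symm_apply]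
  simp [← map_add]

theorem measurable_gradient_reduced (hP : P.Regular L M MΦ) : Measurable (∇ P.reduced) :=
  hP.reduced_smooth.continuous.measurable

theorem measurable_directionAt (hP : P.Regular L M MΦ) (c : GrayBoxController p) (k : ℕ)
    {Ω : Type*} [MeasurableSpace Ω] {v : Ω → ℕ → Vec p} {H : Ω → ℕ → Vec p →L[ℝ] Vec q}
    {w u : Ω → Vec p} (hv : Measurable fun ω => v ω k) (hH : Measurable fun ω => H ω k)
    (hw : Measurable w) (hu : Measurable u) :
    Measurable fun ω => c.directionAt P (H ω) (v ω) k (w ω) (u ω) := by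
  have hf : Measurable P.reduced := hP.reduced_lipschitz.continuous.measurable
  have h1 : Measurable fun ω => w ω + c.δ • v ω k := hw.add (hv.const_smul c.δ)
  have h2 := hP.measurable_inexactGradient.comp (hH.prodMk h1)
  simp only [Function.comp_def] at h2
  have h3 : Measurable fun ω => P.reduced (w ω + c.δ • v ω k) - P.reduced (u ω) :=
    (hf.comp h1).sub (hf.comp hu)
  have h4 : Measurable fun ω => (p / c.δ * (P.reduced (w ω + c.δ • v ω k) - P.reduced (u ω))) •
      v ω k := by fun_prop
  have h5 := h2.const_smul (c.α k)
  have h6 := h4.const_smul (1 - c.α k)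
  have h7 := h5.add h6
  exact h7

/-! ### Bounds along one step of the controller -/

/-- Alignment of the inexact model-based gradient with the true gradient. -/
theorem inner_inexactGradient_ge (hP : P.Regular L M MΦ) (H : Vec p →L[ℝ] Vec q) {δ : ℝ}
    (hδ : 0 ≤ δ) (w : Vec p) {v : Vec p} (hv : ‖v‖ = 1) :
    7 / 20 * ‖∇ P.reduced w‖ ^ 2
        - 5 / 6 * (MΦ * ‖H - P.sensitivity (w + δ • v)‖) ^ 2 - 5 / 7 * (L * δ) ^ 2 ≤
      inner ℝ (∇ P.reduced w) (P.inexactGradient H (w + δ • v)) := by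
  set g := ∇ P.reduced w
  set e := MΦ * ‖H - P.sensitivity (w + δ • v)‖
  have h1 : ‖P.inexactGradient H (w + δ • v) - ∇ P.reduced (w + δ • v)‖ ≤ e :=
    hP.norm_inexactGradient_sub_le H _
  have h2 : ‖∇ P.reduced (w + δ • v) - g‖ ≤ L * δ := by
    have := hP.reduced_smooth.norm_sub_le (w + δ • v) w
    rwa [add_sub_cancel_left, norm_smul, hv, mul_one, Real.norm_eq_abs, abs_of_nonneg hδ] at this
  have h3 : ∀ x y : Vec p, inner ℝ g y = ‖g‖ ^ 2 + inner ℝ g (x - g) + inner ℝ g (y - x) := by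
    intro x y
    rw [← real_inner_self_eq_norm_sq, ← inner_add_right, ← inner_add_right]
    congr 1
    abel
  have h4 : ∀ x (b : ℝ), ‖x‖ ≤ b → -(‖g‖ * b) ≤ inner ℝ g x := fun x b hx =>
    (abs_le.1 ((abs_real_inner_le_norm g x).trans
      (mul_le_mul_of_nonneg_left hx (norm_nonneg g)))).1
  have h5 := h4 _ _ h1
  have h6 := h4 _ _ h2
  have h7 := h3 (∇ P.reduced (w + δ • v)) (P.inexactGradient H (w + δ • v))
  -- Young: `‖g‖e ≤ (3/10)‖g‖² + (5/6)e²` and `‖g‖Lδ ≤ (7/20)‖g‖² + (5/7)(Lδ)²`, which leaves `1 -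
  -- 3/10 - 7/20 = 7/20`.
  have h8 := sq_nonneg (3 / 5 * ‖g‖ - e)
  have h9 := sq_nonneg (7 / 10 * ‖g‖ - L * δ)
  linarith

theorem norm_inexactGradient_sq_le (hP : P.Regular L M MΦ) (H : Vec p →L[ℝ] Vec q) {δ : ℝ}
    (hδ : 0 ≤ δ) (w : Vec p) {v : Vec p} (hv : ‖v‖ = 1) :
    ‖P.inexactGradient H (w + δ • v)‖ ^ 2 ≤ 3 * ‖∇ P.reduced w‖ ^ 2
        + 3 * (MΦ * ‖H - P.sensitivity (w + δ • v)‖) ^ 2 + 3 * (L * δ) ^ 2 := by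
  set g := ∇ P.reduced w
  set e := MΦ * ‖H - P.sensitivity (w + δ • v)‖
  have h1 : ‖P.inexactGradient H (w + δ • v) - ∇ P.reduced (w + δ • v)‖ ≤ e :=
    hP.norm_inexactGradient_sub_le H _
  have h2 : ‖∇ P.reduced (w + δ • v) - g‖ ≤ L * δ := by
    have := hP.reduced_smooth.norm_sub_le (w + δ • v) w
    rwa [add_sub_cancel_left, norm_smul, hv, mul_one, Real.norm_eq_abs, abs_of_nonneg hδ] at this
  have h3 : ‖P.inexactGradient H (w + δ • v)‖ ≤ ‖g‖ + L * δ + e := by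
    have h4 := norm_le_norm_add_norm_sub (∇ P.reduced (w + δ • v))
      (P.inexactGradient H (w + δ • v))
    have h5 := norm_le_norm_add_norm_sub g (∇ P.reduced (w + δ • v))
    rw [norm_sub_rev] at h4 h5
    linarith
  calc _ ≤ (‖g‖ + L * δ + e) ^ 2 := by gcongr
    _ ≤ _ := by nlinarith [sq_nonneg (‖g‖ - L * δ), sq_nonneg (‖g‖ - e), sq_nonneg (L * δ - e)]

/-- Alignment of the zeroth-order estimate with the true gradient, up to a term that is linear in
the exploration vector. -/
theorem inner_gradientEstimate_ge (hP : P.Regular L M MΦ) {δ : ℝ} (hδ : 0 < δ) (uPrev w : Vec p)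
    {v : Vec p} (hv : ‖v‖ = 1) :
    inner ℝ ((p / δ * (P.reduced w - P.reduced uPrev)) • ∇ P.reduced w) v
        + p * inner ℝ (∇ P.reduced w) v ^ 2
        - 13 / 20 * ‖∇ P.reduced w‖ ^ 2 - 5 / 52 * (p * (L * δ)) ^ 2 ≤
      inner ℝ (∇ P.reduced w) (P.gradientEstimate δ uPrev (w + δ • v) v) := by
  set g := ∇ P.reduced w
  have h1 := abs_sub_sub_inner_gradient_le hP.reduced_differentiable hP.reduced_smooth w (δ • v)
  rw [norm_smul, hv, mul_one, Real.norm_eq_abs, sq_abs, inner_smul_right] at h1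
  set ρ := P.reduced (w + δ • v) - P.reduced w - δ * inner ℝ (∇ P.reduced w) v
  have h2 : inner ℝ g (P.gradientEstimate δ uPrev (w + δ • v) v) =
      inner ℝ ((p / δ * (P.reduced w - P.reduced uPrev)) • g) v + p * inner ℝ g v ^ 2
        + p / δ * (ρ * inner ℝ g v) := by
    change inner ℝ g ((p / δ * (P.reduced (w + δ • v) - P.reduced uPrev)) • v) = _
    rw [inner_smul_right, real_inner_smul_left]
    simp only [ρ, g]
    field_simp
    ring
  have h3 : |inner ℝ g v| ≤ ‖g‖ := by simpa [hv] using abs_real_inner_le_norm g v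
  have h4 : |p / δ * (ρ * inner ℝ g v)| ≤ p * (L * δ) / 2 * ‖g‖ := by
    rw [abs_mul, abs_mul, abs_of_nonneg (by positivity : (0 : ℝ) ≤ p / δ)]
    calc p / δ * (|ρ| * |inner ℝ g v|) ≤ p / δ * (L / 2 * δ ^ 2 * ‖g‖) := by gcongr
      _ = _ := by field_simp
  rw [h2]
  -- Young with weight 13/20, because the quadratic term will contribute a full `‖g‖²` on average
  -- and `1 - 13/20` matches the 7/20 of the model-based part.
  nlinarith [sq_nonneg (13 / 5 * ‖g‖ - p * (L * δ)), (abs_le.1 h4).1]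

/-- Keeping `‖∇ P.reduced w‖` in place of its bound `M` is what later permits absorption into the
sum of squared gradients. -/
theorem abs_reduced_add_sub_le (hP : P.Regular L M MΦ) {δ : ℝ} (hδ : 0 ≤ δ) (w : Vec p)
    {v : Vec p} (hv : ‖v‖ = 1) :
    |P.reduced (w + δ • v) - P.reduced w| ≤ δ * (‖∇ P.reduced w‖ + L * δ / 2) := by
  have h1 := abs_sub_sub_inner_gradient_le hP.reduced_differentiable hP.reduced_smooth w (δ • v)
  rw [norm_smul, hv, mul_one, Real.norm_eq_abs, sq_abs, inner_smul_right] at h1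
  have h3 : |δ * inner ℝ (∇ P.reduced w) v| ≤ δ * ‖∇ P.reduced w‖ := by
    rw [abs_mul, abs_of_nonneg hδ]
    gcongr
    simpa [hv] using abs_real_inner_le_norm (∇ P.reduced w) v
  rw [abs_le] at *
  constructor <;> nlinarith

/-- The residual-feedback estimate has a second moment controlled by the previous step and by the
gradients at the two latest candidates. -/
theorem norm_gradientEstimate_sq_le (hP : P.Regular L M MΦ) {δ : ℝ} (hδ : 0 < δ)
    (wPrev w : Vec p) {vPrev v : Vec p} (hv : ‖v‖ = 1) (hvPrev : ‖vPrev‖ = 1) :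
    ‖P.gradientEstimate δ (wPrev + δ • vPrev) (w + δ • v) v‖ ^ 2 ≤
      2 * (p * M / δ * ‖w - wPrev‖) ^ 2
        + 6 * p ^ 2 * (‖∇ P.reduced w‖ ^ 2 + ‖∇ P.reduced wPrev‖ ^ 2 + (L * δ) ^ 2) := by
  have h1 := hP.abs_reduced_add_sub_le hδ.le w hv
  have h2 := hP.abs_reduced_add_sub_le hδ.le wPrev hvPrev
  have h3 : |P.reduced w - P.reduced wPrev| ≤ M * ‖w - wPrev‖ :=
    hP.reduced_lipschitz.norm_sub_le w wPrev
  set a := ‖∇ P.reduced w‖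
  set b := ‖∇ P.reduced wPrev‖
  set D := P.reduced (w + δ • v) - P.reduced (wPrev + δ • vPrev)
  have h4 : |D| ≤ M * ‖w - wPrev‖ + δ * (a + b + L * δ) := by
    simp only [D]
    rw [abs_le] at *
    constructor <;> linarith
  have h5 : ‖P.gradientEstimate δ (wPrev + δ • vPrev) (w + δ • v) v‖ = p / δ * |D| := by
    change ‖(p / δ * D) • v‖ = _
    rw [norm_smul, hv, mul_one, Real.norm_eq_abs, abs_mul,
      abs_of_nonneg (by positivity : (0 : ℝ) ≤ p / δ)]
  have h6 : p / δ * |D| ≤ p * M / δ * ‖w - wPrev‖ + p * (a + b + L * δ) := by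
    calc p / δ * |D| ≤ p / δ * (M * ‖w - wPrev‖ + δ * (a + b + L * δ)) := by gcongr
      _ = _ := by field_simp
  rw [h5]
  calc (p / δ * |D|) ^ 2 ≤ (p * M / δ * ‖w - wPrev‖ + p * (a + b + L * δ)) ^ 2 := by gcongr
    _ ≤ 2 * (p * M / δ * ‖w - wPrev‖) ^ 2 + 2 * p ^ 2 * (a + b + L * δ) ^ 2 := by
        nlinarith [sq_nonneg (p * M / δ * ‖w - wPrev‖ - p * (a + b + L * δ))]
    _ ≤ _ := by
        have : (a + b + L * δ) ^ 2 ≤ 3 * (a ^ 2 + b ^ 2 + (L * δ) ^ 2) := by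
          nlinarith [sq_nonneg (a - b), sq_nonneg (a - L * δ), sq_nonneg (b - L * δ)]
        nlinarith [mul_le_mul_of_nonneg_left this (by positivity : (0 : ℝ) ≤ 2 * p ^ 2)]

/-- A cruder bound valid for an arbitrary previous input; it serves for integrability and for the
first step, where `uInit` has no form `w + δ v`. -/
theorem norm_gradientEstimate_le (hP : P.Regular L M MΦ) {δ : ℝ} (hδ : 0 < δ)
    (uPrev w : Vec p) {v : Vec p} (hv : ‖v‖ = 1) :
    ‖P.gradientEstimate δ uPrev (w + δ • v) v‖ ≤ p * M / δ * (‖w - uPrev‖ + δ) := by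
  have h1 : |P.reduced (w + δ • v) - P.reduced uPrev| ≤ M * ‖w + δ • v - uPrev‖ :=
    hP.reduced_lipschitz.norm_sub_le _ _
  have h2 : ‖w + δ • v - uPrev‖ ≤ ‖w - uPrev‖ + δ := by
    have := norm_add_le (w - uPrev) (δ • v)
    rwa [norm_smul, hv, mul_one, Real.norm_eq_abs, abs_of_pos hδ, sub_add_eq_add_sub] at this
  change ‖(p / δ * (P.reduced (w + δ • v) - P.reduced uPrev)) • v‖ ≤ _
  rw [norm_smul, hv, mul_one, Real.norm_eq_abs, abs_mul,
    abs_of_nonneg (by positivity : (0 : ℝ) ≤ p / δ)]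
  calc _ ≤ p / δ * (M * (‖w - uPrev‖ + δ)) := by gcongr; exact h1.trans (by gcongr)
    _ = _ := by ring

/-- The descent inequality for the reduced objective. -/
theorem reduced_sub_smul_le (hP : P.Regular L M MΦ) (w x : Vec p) (η : ℝ) :
    P.reduced (w - η • x) ≤
      P.reduced w - η * inner ℝ (∇ P.reduced w) x + L / 2 * η ^ 2 * ‖x‖ ^ 2 := by
  have h := abs_sub_sub_inner_gradient_le hP.reduced_differentiable hP.reduced_smooth w (-(η • x))
  rw [norm_neg, norm_smul, inner_neg_right, inner_smul_right, mul_pow, Real.norm_eq_abs, sq_abs,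
    ← sub_eq_add_neg] at h
  nlinarith [(abs_le.1 h).2]

theorem optimalValue_le (hP : P.Regular L M MΦ) (u : Vec p) : P.optimalValue ≤ P.reduced u :=
  ciInf_le hP.reduced_bddBelow u

end SteadyStateProblem.Regular

/-- The squared norm of a convex combination. -/
theorem norm_convexCombination_sq_le {E : Type*} [NormedAddCommGroup E] [InnerProductSpace ℝ E]
    {a : ℝ} (h0 : 0 ≤ a) (h1 : a ≤ 1) (x y : E) :
    ‖a • x + (1 - a) • y‖ ^ 2 ≤ a * ‖x‖ ^ 2 + (1 - a) * ‖y‖ ^ 2 := by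
  have hn := norm_add_le (a • x) ((1 - a) • y)
  rw [norm_smul, norm_smul, Real.norm_eq_abs, Real.norm_eq_abs, abs_of_nonneg h0,
    abs_of_nonneg (sub_nonneg.2 h1)] at hn
  calc _ ≤ (a * ‖x‖ + (1 - a) * ‖y‖) ^ 2 := by gcongr
    _ ≤ _ := by
      nlinarith [mul_nonneg (mul_nonneg h0 (sub_nonneg.2 h1)) (sq_nonneg (‖x‖ - ‖y‖))]

/-! ### Measurability and square integrability of the closed loop. -/

/-- The information available before the exploration vector `v k` is drawn. -/
abbrev pastInformation {Ω : Type*} [m : MeasurableSpace Ω] (ℱ : Filtration ℕ m) :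
    ℕ → MeasurableSpace Ω
  | 0 => ⊥
  | k + 1 => ℱ k

theorem pastInformation_le {Ω : Type*} [m : MeasurableSpace Ω] (ℱ : Filtration ℕ m) (k : ℕ) :
    pastInformation ℱ k ≤ ℱ k := by
  cases k with
  | zero => exact bot_le
  | succ k => exact ℱ.mono k.le_succ

/-- At time zero the candidate and previous input are deterministic, so the trivial σ-algebra
suffices and independence is automatic. -/
theorem IsExploration.indep_past {Ω : Type*} [m : MeasurableSpace Ω] {p q : ℕ} {μ : Measure Ω}
    [IsProbabilityMeasure μ] {ℱ : Filtration ℕ m} {v : Ω → ℕ → Vec p}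
    {H : Ω → ℕ → Vec p →L[ℝ] Vec q} (h : IsExploration μ ℱ v H) (k : ℕ) :
    Indep (MeasurableSpace.comap (fun ω => v ω k) inferInstance) (pastInformation ℱ k) μ := by
  cases k with
  | zero => exact indep_bot_right _
  | succ k => exact h.exploration_indep k

/-- The hypotheses on the closed loop that do not involve the size of the parameters. -/
structure IsClosedLoop {Ω : Type*} [m : MeasurableSpace Ω] {p q r : ℕ} (μ : Measure Ω)
    (ℱ : Filtration ℕ m) (v : Ω → ℕ → Vec p) (H : Ω → ℕ → Vec p →L[ℝ] Vec q)
    (P : SteadyStateProblem p q r) (c : GrayBoxController p) (L M MΦ : ℝ≥0) : Prop where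
  dim_pos : 0 < p
  regular : P.Regular L M MΦ
  exploration : IsExploration μ ℱ v H
  coeff_mem : ∀ k, c.α k ∈ Set.Icc (0 : ℝ) 1
  step_pos : 0 < c.η
  smoothing_pos : 0 < c.δ

/-- The sensitivity errors have finite second moments. -/
def SquareIntegrableError {Ω : Type*} [MeasurableSpace Ω] {p q r : ℕ} (μ : Measure Ω)
    (v : Ω → ℕ → Vec p) (H : Ω → ℕ → Vec p →L[ℝ] Vec q)
    (P : SteadyStateProblem p q r) (c : GrayBoxController p) : Prop :=
  ∀ k, Integrable (fun ω => c.sensitivityError P (H ω) (v ω) k ^ 2) μ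

namespace IsClosedLoop

variable {Ω : Type*} [m : MeasurableSpace Ω] {p q r : ℕ} {μ : Measure Ω}
  {ℱ : Filtration ℕ m} {v : Ω → ℕ → Vec p} {H : Ω → ℕ → Vec p →L[ℝ] Vec q}
  {P : SteadyStateProblem p q r} {c : GrayBoxController p} {L M MΦ : ℝ≥0}

theorem measurable_exploration (h : IsClosedLoop μ ℱ v H P c L M MΦ) (k : ℕ) :
    Measurable fun ω => v ω k :=
  (h.exploration.exploration_adapted k).mono (ℱ.le k) le_rfl

theorem measurable_state_past (h : IsClosedLoop μ ℱ v H P c L M MΦ) (k : ℕ) :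
    Measurable[pastInformation ℱ k] fun ω => c.state P (H ω) (v ω) k := by
  induction k with
  | zero => exact measurable_const
  | succ k ih =>
    have hs : Measurable[ℱ k] fun ω => c.state P (H ω) (v ω) k :=
      ih.mono (pastInformation_le ℱ k) le_rfl
    have hv := h.exploration.exploration_adapted k
    have hd : Measurable[ℱ k] fun ω => c.directionAt P (H ω) (v ω) k
        (c.state P (H ω) (v ω) k).1 (c.state P (H ω) (v ω) k).2 :=
      @SteadyStateProblem.Regular.measurable_directionAt p q r P L M MΦ h.regular c k Ω (ℱ k) v H
        (fun ω => (c.state P (H ω) (v ω) k).1) (fun ω => (c.state P (H ω) (v ω) k).2) hv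
        (h.exploration.sensitivity_adapted k) hs.fst hs.snd
    exact Measurable.prodMk (hs.fst.sub (hd.const_smul c.η)) (hs.fst.add (hv.const_smul c.δ))

theorem measurable_state (h : IsClosedLoop μ ℱ v H P c L M MΦ) (k : ℕ) :
    Measurable fun ω => c.state P (H ω) (v ω) k :=
  (h.measurable_state_past k).mono ((pastInformation_le ℱ k).trans (ℱ.le k)) le_rfl

theorem measurable_candidate (h : IsClosedLoop μ ℱ v H P c L M MΦ) (k : ℕ) :
    Measurable fun ω => c.candidate P (H ω) (v ω) k :=
  (h.measurable_state k).fst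

theorem measurable_direction (h : IsClosedLoop μ ℱ v H P c L M MΦ) (k : ℕ) :
    Measurable fun ω => c.direction P (H ω) (v ω) k :=
  h.regular.measurable_directionAt c k (h.measurable_exploration k)
    ((h.exploration.sensitivity_adapted k).mono (ℱ.le k) le_rfl) (h.measurable_state k).fst
    (h.measurable_state k).snd

theorem measurable_sensitivityError (h : IsClosedLoop μ ℱ v H P c L M MΦ) (k : ℕ) :
    Measurable fun ω => c.sensitivityError P (H ω) (v ω) k := by
  have h1 : Measurable fun ω => H ω k :=
    (h.exploration.sensitivity_adapted k).mono (ℱ.le k) le_rfl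
  have h2 : Measurable fun ω => c.input P (H ω) (v ω) k :=
    (h.measurable_candidate k).add ((h.measurable_exploration k).const_smul c.δ)
  exact (h1.sub ((measurable_fderiv ℝ P.output).comp h2)).norm

theorem ae_norm_exploration (h : IsClosedLoop μ ℱ v H P c L M MΦ) : ∀ᵐ ω ∂μ, ∀ k, ‖v ω k‖ = 1 :=
  ae_all_iff.2 fun k => ae_norm_eq_one_of_map_eq_uniformSphere (h.measurable_exploration k)
    (h.exploration.exploration_law k)

theorem norm_direction_le (h : IsClosedLoop μ ℱ v H P c L M MΦ) {k : ℕ} {ω : Ω}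
    (hv : ‖v ω k‖ = 1) :
    ‖c.direction P (H ω) (v ω) k‖ ≤ M + MΦ * c.sensitivityError P (H ω) (v ω) k
      + p * M / c.δ *
        (‖(c.state P (H ω) (v ω) k).1 - (c.state P (H ω) (v ω) k).2‖ + c.δ) := by
  obtain ⟨h0, h1⟩ := h.coeff_mem k
  set w := (c.state P (H ω) (v ω) k).1
  set u := (c.state P (H ω) (v ω) k).2
  have h2 : ‖P.inexactGradient (H ω k) (w + c.δ • v ω k)‖ ≤
      M + MΦ * c.sensitivityError P (H ω) (v ω) k := by
    have h3 := h.regular.norm_inexactGradient_sub_le (H ω k) (w + c.δ • v ω k)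
    have h4 := h.regular.reduced_lipschitz.norm_gradient_le (w + c.δ • v ω k)
    exact (norm_le_norm_add_norm_sub' _ _).trans (add_le_add h4 h3)
  have h3 := h.regular.norm_gradientEstimate_le h.smoothing_pos u w hv
  have h4 : ‖c.direction P (H ω) (v ω) k‖ ≤
      c.α k * ‖P.inexactGradient (H ω k) (w + c.δ • v ω k)‖
        + (1 - c.α k) * ‖P.gradientEstimate c.δ u (w + c.δ • v ω k) (v ω k)‖ := by
    have := norm_add_le (c.α k • P.inexactGradient (H ω k) (w + c.δ • v ω k))
      ((1 - c.α k) • P.gradientEstimate c.δ u (w + c.δ • v ω k) (v ω k))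
    rwa [norm_smul, norm_smul, Real.norm_eq_abs, Real.norm_eq_abs, abs_of_nonneg h0,
      abs_of_nonneg (sub_nonneg.2 h1)] at this
  have h5 := mul_le_of_le_one_left
    (norm_nonneg (P.inexactGradient (H ω k) (w + c.δ • v ω k))) h1
  have h6 := mul_le_of_le_one_left
    (norm_nonneg (P.gradientEstimate c.δ u (w + c.δ • v ω k) (v ω k))) (sub_le_self 1 h0)
  linarith

theorem memLp_sensitivityError (h : IsClosedLoop μ ℱ v H P c L M MΦ)
    (he : SquareIntegrableError μ v H P c) (k : ℕ) :
    MemLp (fun ω => c.sensitivityError P (H ω) (v ω) k) 2 μ :=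
  (memLp_two_iff_integrable_sq (h.measurable_sensitivityError k).aestronglyMeasurable).2 (he k)

variable [IsProbabilityMeasure μ]

theorem memLp_direction_of_state (h : IsClosedLoop μ ℱ v H P c L M MΦ)
    (he : SquareIntegrableError μ v H P c) {k : ℕ}
    (h1 : MemLp (fun ω => (c.state P (H ω) (v ω) k).1) 2 μ)
    (h2 : MemLp (fun ω => (c.state P (H ω) (v ω) k).2) 2 μ) :
    MemLp (fun ω => c.direction P (H ω) (v ω) k) 2 μ := by
  have hb : MemLp (fun ω => M + MΦ * c.sensitivityError P (H ω) (v ω) k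
      + p * M / c.δ *
        (‖(c.state P (H ω) (v ω) k).1 - (c.state P (H ω) (v ω) k).2‖ + c.δ)) 2 μ :=
    ((memLp_const (M : ℝ)).add ((h.memLp_sensitivityError he k).const_mul _)).add
      (((h1.sub h2).norm.add (memLp_const c.δ)).const_mul _)
  refine hb.mono' (h.measurable_direction k).aestronglyMeasurable ?_
  filter_upwards [h.ae_norm_exploration] with ω hω using h.norm_direction_le (hω k)

theorem memLp_exploration (h : IsClosedLoop μ ℱ v H P c L M MΦ) (k : ℕ) :
    MemLp (fun ω => v ω k) 2 μ :=
  MemLp.of_bound (h.measurable_exploration k).aestronglyMeasurable 1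
    (by filter_upwards [h.ae_norm_exploration] with ω hω using (hω k).le)

/-- Both components go through one induction: the direction grows at most linearly in their
difference and in the sensitivity error, so square integrability propagates. -/
theorem memLp_state (h : IsClosedLoop μ ℱ v H P c L M MΦ)
    (he : SquareIntegrableError μ v H P c) (k : ℕ) :
    MemLp (fun ω => (c.state P (H ω) (v ω) k).1) 2 μ ∧
      MemLp (fun ω => (c.state P (H ω) (v ω) k).2) 2 μ := by
  induction k with
  | zero => exact ⟨memLp_const c.w₀, memLp_const c.uInit⟩
  | succ k ih =>
    exact ⟨ih.1.sub ((h.memLp_direction_of_state he ih.1 ih.2).const_smul c.η),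
      ih.1.add ((h.memLp_exploration k).const_smul c.δ)⟩

theorem integrable_norm_direction_sq (h : IsClosedLoop μ ℱ v H P c L M MΦ)
    (he : SquareIntegrableError μ v H P c) (k : ℕ) :
    Integrable (fun ω => ‖c.direction P (H ω) (v ω) k‖ ^ 2) μ :=
  (memLp_two_iff_integrable_sq_norm (h.measurable_direction k).aestronglyMeasurable).1
    (h.memLp_direction_of_state he (h.memLp_state he k).1 (h.memLp_state he k).2)

theorem integrable_reduced_comp (h : IsClosedLoop μ ℱ v H P c L M MΦ) {X : Ω → Vec p}
    (hX : Measurable X) (hX' : MemLp X 2 μ) : Integrable (fun ω => P.reduced (X ω)) μ := by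
  have h1 : Integrable X μ := hX'.integrable one_le_two
  refine ((h1.norm.const_mul (M : ℝ)).add (integrable_const |P.reduced 0|)).mono'
    (h.regular.reduced_lipschitz.continuous.measurable.comp hX).aestronglyMeasurable ?_
  filter_upwards with ω
  have h2 := h.regular.reduced_lipschitz.norm_sub_le (X ω) 0
  rw [sub_zero] at h2
  exact (norm_le_norm_add_norm_sub' _ (P.reduced 0)).trans (by
    rw [add_comm]; exact add_le_add h2 le_rfl)

theorem integrable_reduced_candidate (h : IsClosedLoop μ ℱ v H P c L M MΦ)
    (he : SquareIntegrableError μ v H P c) (k : ℕ) :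
    Integrable (fun ω => P.reduced (c.candidate P (H ω) (v ω) k)) μ :=
  h.integrable_reduced_comp (h.measurable_candidate k) (h.memLp_state he k).1

theorem integrable_norm_gradient_sq (h : IsClosedLoop μ ℱ v H P c L M MΦ) (k : ℕ) :
    Integrable (fun ω => ‖∇ P.reduced (c.candidate P (H ω) (v ω) k)‖ ^ 2) μ := by
  refine Integrable.of_bound (C := (M : ℝ) ^ 2)
    ((h.regular.measurable_gradient_reduced.comp
      (h.measurable_candidate k)).norm.pow_const 2).aestronglyMeasurable ?_
  filter_upwards with ω
  rw [norm_pow, norm_norm]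
  gcongr
  exact h.regular.reduced_lipschitz.norm_gradient_le _

end IsClosedLoop

/-! ### Expected one-step inequalities. -/

namespace IsClosedLoop

variable {Ω : Type*} [m : MeasurableSpace Ω] {p q r : ℕ} {μ : Measure Ω} [IsProbabilityMeasure μ]
  {ℱ : Filtration ℕ m} {v : Ω → ℕ → Vec p} {H : Ω → ℕ → Vec p →L[ℝ] Vec q}
  {P : SteadyStateProblem p q r} {c : GrayBoxController p} {L M MΦ : ℝ≥0}

/-- The linear term of the zeroth-order estimate averages out. -/
theorem linear_term (h : IsClosedLoop μ ℱ v H P c L M MΦ)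
    (he : SquareIntegrableError μ v H P c) (k : ℕ) :
    Integrable (fun ω => inner ℝ ((p / c.δ * (P.reduced (c.state P (H ω) (v ω) k).1
        - P.reduced (c.state P (H ω) (v ω) k).2)) • ∇ P.reduced (c.state P (H ω) (v ω) k).1)
        (v ω k)) μ ∧
      ∫ ω, inner ℝ ((p / c.δ * (P.reduced (c.state P (H ω) (v ω) k).1
        - P.reduced (c.state P (H ω) (v ω) k).2)) • ∇ P.reduced (c.state P (H ω) (v ω) k).1)
        (v ω k) ∂μ = 0 := by
  have hle : pastInformation ℱ k ≤ m := (pastInformation_le ℱ k).trans (ℱ.le k)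
  have hs := h.measurable_state_past k
  have hf : Measurable P.reduced := h.regular.reduced_lipschitz.continuous.measurable
  have h1 : Measurable[pastInformation ℱ k] fun ω =>
      p / c.δ * (P.reduced (c.state P (H ω) (v ω) k).1
        - P.reduced (c.state P (H ω) (v ω) k).2) :=
    ((hf.comp hs.fst).sub (hf.comp hs.snd)).const_mul _
  have h2 : Measurable[pastInformation ℱ k] fun ω =>
      ∇ P.reduced (c.state P (H ω) (v ω) k).1 :=
    h.regular.measurable_gradient_reduced.comp hs.fst
  have h3 := h1.smul h2
  have hL := h.memLp_state he k
  have hint : Integrable (fun ω => p / c.δ * (P.reduced (c.state P (H ω) (v ω) k).1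
        - P.reduced (c.state P (H ω) (v ω) k).2)) μ :=
    ((h.integrable_reduced_comp (h.measurable_state k).fst hL.1).sub
      (h.integrable_reduced_comp (h.measurable_state k).snd hL.2)).const_mul _
  have hW : Integrable (fun ω => (p / c.δ * (P.reduced (c.state P (H ω) (v ω) k).1
        - P.reduced (c.state P (H ω) (v ω) k).2)) • ∇ P.reduced (c.state P (H ω) (v ω) k).1) μ := by
    refine (hint.norm.mul_const (M : ℝ)).mono' (h3.mono hle le_rfl).aestronglyMeasurable ?_
    filter_upwards with ω
    rw [norm_smul]
    gcongr
    exact h.regular.reduced_lipschitz.norm_gradient_le _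
  have hv := h.measurable_exploration k
  have hlaw := h.exploration.exploration_law k
  exact ⟨integrable_inner_of_map_eq_uniformSphere hle hv hlaw h3 hW,
    integral_inner_eq_zero_of_indep hle hv hlaw (h.exploration.indep_past k) h3 hW⟩

/-- The quadratic term of the zeroth-order estimate averages to the squared gradient norm. -/
theorem quadratic_term (h : IsClosedLoop μ ℱ v H P c L M MΦ) (k : ℕ) :
    Integrable (fun ω => p * inner ℝ (∇ P.reduced (c.candidate P (H ω) (v ω) k)) (v ω k) ^ 2) μ ∧
      ∫ ω, p * inner ℝ (∇ P.reduced (c.candidate P (H ω) (v ω) k)) (v ω k) ^ 2 ∂μ =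
        ∫ ω, ‖∇ P.reduced (c.candidate P (H ω) (v ω) k)‖ ^ 2 ∂μ := by
  have hle : pastInformation ℱ k ≤ m := (pastInformation_le ℱ k).trans (ℱ.le k)
  have h2 : Measurable[pastInformation ℱ k] fun ω =>
      ∇ P.reduced (c.candidate P (H ω) (v ω) k) :=
    h.regular.measurable_gradient_reduced.comp (h.measurable_state_past k).fst
  have hv := h.measurable_exploration k
  have hlaw := h.exploration.exploration_law k
  have hW := h.integrable_norm_gradient_sq k
  exact ⟨(integrable_inner_sq_of_map_eq_uniformSphere hle hv hlaw h2 hW).const_mul _,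
    integral_inner_sq_of_indep hle hv hlaw (h.exploration.indep_past k) h2 h.dim_pos hW⟩

/-- Expected decrease of the reduced objective in one step. -/
theorem integral_reduced_succ_le (h : IsClosedLoop μ ℱ v H P c L M MΦ)
    (he : SquareIntegrableError μ v H P c) (k : ℕ) :
    ∫ ω, P.reduced (c.candidate P (H ω) (v ω) (k + 1)) ∂μ ≤
      ∫ ω, P.reduced (c.candidate P (H ω) (v ω) k) ∂μ
        - c.η * (7 / 20 * ∫ ω, ‖∇ P.reduced (c.candidate P (H ω) (v ω) k)‖ ^ 2 ∂μ
          - c.α k * (5 / 6 * MΦ ^ 2 * ∫ ω, c.sensitivityError P (H ω) (v ω) k ^ 2 ∂μ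
              + 5 / 7 * (L * c.δ) ^ 2)
          - (1 - c.α k) * (5 / 52 * (p * (L * c.δ)) ^ 2))
        + L / 2 * c.η ^ 2 * ∫ ω, ‖c.direction P (H ω) (v ω) k‖ ^ 2 ∂μ := by
  obtain ⟨h0, h1⟩ := h.coeff_mem k
  have h1' := sub_nonneg.2 h1
  have i1 := h.integrable_reduced_candidate he k
  have i2 := h.integrable_norm_gradient_sq k
  have i3 := he k
  obtain ⟨i4, e4⟩ := h.linear_term he k
  obtain ⟨i5, e5⟩ := h.quadratic_term k
  have i6 := h.integrable_norm_direction_sq he k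
  set X1 := fun ω => P.reduced (c.candidate P (H ω) (v ω) k) with hX1
  set X2 := fun ω => ‖∇ P.reduced (c.candidate P (H ω) (v ω) k)‖ ^ 2 with hX2
  set X3 := fun ω => c.sensitivityError P (H ω) (v ω) k ^ 2 with hX3
  set X4 := fun ω => inner ℝ ((p / c.δ * (P.reduced (c.state P (H ω) (v ω) k).1
        - P.reduced (c.state P (H ω) (v ω) k).2)) • ∇ P.reduced (c.state P (H ω) (v ω) k).1)
        (v ω k) with hX4
  set X5 := fun ω => p * inner ℝ (∇ P.reduced (c.candidate P (H ω) (v ω) k)) (v ω k) ^ 2 with hX5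
  set X6 := fun ω => ‖c.direction P (H ω) (v ω) k‖ ^ 2 with hX6
  -- The signed coefficient of `X2` is provisional: after integration `X4` vanishes and `X5` has the
  -- integral of `X2`, so the total becomes `-(7/20) η` for every value of `α k`.
  have hpt : ∀ᵐ ω ∂μ, P.reduced (c.candidate P (H ω) (v ω) (k + 1)) ≤
      X1 ω + (-(c.η * (7 / 20 * c.α k - 13 / 20 * (1 - c.α k)))) * X2 ω
        + c.η * (c.α k * (5 / 6 * MΦ ^ 2)) * X3 ω + (-(c.η * (1 - c.α k))) * X4 ω
        + (-(c.η * (1 - c.α k))) * X5 ω + L / 2 * c.η ^ 2 * X6 ω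
        + c.η * (c.α k * (5 / 7 * (L * c.δ) ^ 2)
          + (1 - c.α k) * (5 / 52 * (p * (L * c.δ)) ^ 2)) := by
    filter_upwards [h.ae_norm_exploration] with ω hω
    have d1 := h.regular.reduced_sub_smul_le (c.candidate P (H ω) (v ω) k)
      (c.direction P (H ω) (v ω) k) c.η
    have d2 := h.regular.inner_inexactGradient_ge (H ω k) h.smoothing_pos.le
      (c.candidate P (H ω) (v ω) k) (hω k)
    have d3 := h.regular.inner_gradientEstimate_ge h.smoothing_pos (c.state P (H ω) (v ω) k).2
      (c.candidate P (H ω) (v ω) k) (hω k)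
    have d4 : inner ℝ (∇ P.reduced (c.candidate P (H ω) (v ω) k)) (c.direction P (H ω) (v ω) k) =
        c.α k * inner ℝ (∇ P.reduced (c.candidate P (H ω) (v ω) k))
          (P.inexactGradient (H ω k) (c.candidate P (H ω) (v ω) k + c.δ • v ω k))
        + (1 - c.α k) * inner ℝ (∇ P.reduced (c.candidate P (H ω) (v ω) k))
          (P.gradientEstimate c.δ (c.state P (H ω) (v ω) k).2
            (c.candidate P (H ω) (v ω) k + c.δ • v ω k) (v ω k)) := by
      rw [← real_inner_smul_right, ← real_inner_smul_right, ← inner_add_right]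
      rfl
    rw [c.candidate_succ]
    change _ ≤ X1 ω - _ + L / 2 * c.η ^ 2 * X6 ω at d1
    change X4 ω + X5 ω - 13 / 20 * X2 ω - _ ≤ _ at d3
    change 7 / 20 * X2 ω - 5 / 6 * (MΦ * c.sensitivityError P (H ω) (v ω) k) ^ 2 - _ ≤ _ at d2
    rw [mul_pow] at d2
    change 7 / 20 * X2 ω - 5 / 6 * (MΦ ^ 2 * X3 ω) - _ ≤ _ at d2
    rw [d4] at d1
    have d5 := mul_le_mul_of_nonneg_left d2 (mul_nonneg h.step_pos.le h0)
    have d6 := mul_le_mul_of_nonneg_left d3 (mul_nonneg h.step_pos.le h1')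
    linarith
  have hle := integral_mono_ae (h.integrable_reduced_candidate he (k + 1))
    ((((((i1.add (i2.const_mul _)).add (i3.const_mul _)).add (i4.const_mul _)).add
      (i5.const_mul _)).add (i6.const_mul _)).add (integrable_const _)) hpt
  refine hle.trans (le_of_eq ?_)
  rw [integral_add' (((((i1.add (i2.const_mul _)).add (i3.const_mul _)).add (i4.const_mul _)).add
      (i5.const_mul _)).add (i6.const_mul _)) (integrable_const _),
    integral_add' ((((i1.add (i2.const_mul _)).add (i3.const_mul _)).add (i4.const_mul _)).add
      (i5.const_mul _)) (i6.const_mul _),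
    integral_add' (((i1.add (i2.const_mul _)).add (i3.const_mul _)).add (i4.const_mul _))
      (i5.const_mul _),
    integral_add' ((i1.add (i2.const_mul _)).add (i3.const_mul _)) (i4.const_mul _),
    integral_add' (i1.add (i2.const_mul _)) (i3.const_mul _),
    integral_add' i1 (i2.const_mul _)]
  simp only [integral_const_mul, integral_const, e4, e5]
  simp
  ring

/-- Recursive bound on the second moment of the update direction. -/
theorem integral_norm_direction_succ_sq_le (h : IsClosedLoop μ ℱ v H P c L M MΦ)
    (he : SquareIntegrableError μ v H P c) (hstep : 8 * (c.η * (p * M / c.δ)) ^ 2 ≤ 1) (k : ℕ) :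
    ∫ ω, ‖c.direction P (H ω) (v ω) (k + 1)‖ ^ 2 ∂μ ≤
      1 / 4 * ∫ ω, ‖c.direction P (H ω) (v ω) k‖ ^ 2 ∂μ
        + 6 * p ^ 2 * ∫ ω, ‖∇ P.reduced (c.candidate P (H ω) (v ω) k)‖ ^ 2 ∂μ
        + (6 * p ^ 2 * ∫ ω, ‖∇ P.reduced (c.candidate P (H ω) (v ω) (k + 1))‖ ^ 2 ∂μ
          + 3 * c.α (k + 1) *
              (MΦ ^ 2 * ∫ ω, c.sensitivityError P (H ω) (v ω) (k + 1) ^ 2 ∂μ + (L * c.δ) ^ 2)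
          + (1 - c.α (k + 1)) * (6 * p ^ 2 * (L * c.δ) ^ 2)) := by
  obtain ⟨h0, h1⟩ := h.coeff_mem (k + 1)
  have h1' := sub_nonneg.2 h1
  have hp : (1 : ℝ) ≤ p := by exact_mod_cast h.dim_pos
  have i1 := h.integrable_norm_direction_sq he k
  have i2 := h.integrable_norm_gradient_sq k
  have i3 := h.integrable_norm_gradient_sq (k + 1)
  have i4 := he (k + 1)
  set X1 := fun ω => ‖c.direction P (H ω) (v ω) k‖ ^ 2 with hX1
  set X2 := fun ω => ‖∇ P.reduced (c.candidate P (H ω) (v ω) k)‖ ^ 2 with hX2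
  set X3 := fun ω => ‖∇ P.reduced (c.candidate P (H ω) (v ω) (k + 1))‖ ^ 2 with hX3
  set X4 := fun ω => c.sensitivityError P (H ω) (v ω) (k + 1) ^ 2 with hX4
  have hpt : ∀ᵐ ω ∂μ, ‖c.direction P (H ω) (v ω) (k + 1)‖ ^ 2 ≤
      1 / 4 * X1 ω + 6 * p ^ 2 * X2 ω + 6 * p ^ 2 * X3 ω
        + 3 * c.α (k + 1) * MΦ ^ 2 * X4 ω
        + (3 * c.α (k + 1) * (L * c.δ) ^ 2
          + (1 - c.α (k + 1)) * (6 * p ^ 2 * (L * c.δ) ^ 2)) := by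
    filter_upwards [h.ae_norm_exploration] with ω hω
    have d1 := h.regular.norm_inexactGradient_sq_le (H ω (k + 1)) h.smoothing_pos.le
      (c.candidate P (H ω) (v ω) (k + 1)) (hω (k + 1))
    have d2 := h.regular.norm_gradientEstimate_sq_le h.smoothing_pos
      (c.candidate P (H ω) (v ω) k) (c.candidate P (H ω) (v ω) (k + 1)) (hω (k + 1)) (hω k)
    have d3 := norm_convexCombination_sq_le h0 h1
      (P.inexactGradient (H ω (k + 1)) (c.input P (H ω) (v ω) (k + 1)))
      (P.gradientEstimate c.δ (c.input P (H ω) (v ω) k) (c.input P (H ω) (v ω) (k + 1))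
        (v ω (k + 1)))
    have d4 : ‖c.candidate P (H ω) (v ω) (k + 1) - c.candidate P (H ω) (v ω) k‖ =
        c.η * ‖c.direction P (H ω) (v ω) k‖ := by
      rw [c.candidate_succ, sub_sub_cancel_left, norm_neg, norm_smul, Real.norm_eq_abs,
        abs_of_pos h.step_pos]
    rw [d4] at d2
    have d5 : 2 * (p * M / c.δ * (c.η * ‖c.direction P (H ω) (v ω) k‖)) ^ 2 ≤ 1 / 4 * X1 ω := by
      have := mul_le_mul_of_nonneg_right hstep (sq_nonneg ‖c.direction P (H ω) (v ω) k‖)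
      calc _ = 1 / 4 * (8 * (c.η * (p * M / c.δ)) ^ 2 * ‖c.direction P (H ω) (v ω) k‖ ^ 2) := by
            ring
        _ ≤ 1 / 4 * (1 * ‖c.direction P (H ω) (v ω) k‖ ^ 2) := by gcongr
        _ = _ := by simp [hX1]
    change _ ≤ 3 * X3 ω + 3 * (MΦ * c.sensitivityError P (H ω) (v ω) (k + 1)) ^ 2 + _ at d1
    rw [mul_pow (MΦ : ℝ)] at d1
    change _ ≤ 3 * X3 ω + 3 * (MΦ ^ 2 * X4 ω) + _ at d1
    change _ ≤ _ + 6 * p ^ 2 * (X3 ω + X2 ω + _) at d2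
    have hX1' : 0 ≤ X1 ω := sq_nonneg _
    have hX2' : 0 ≤ X2 ω := sq_nonneg _
    have hX3' : 0 ≤ X3 ω := sq_nonneg _
    have hp2 : (1 : ℝ) ≤ (p : ℝ) ^ 2 := one_le_pow₀ hp
    have d6 := mul_le_mul_of_nonneg_left d1 h0
    have d7 := mul_le_mul_of_nonneg_left (d2.trans (add_le_add d5 le_rfl)) h1'
    have d8 := d3.trans (add_le_add d6 d7)
    -- `d9` and `d10` restore full weight to terms that carry only `1 - α` or a smaller constant;
    -- `p² ≥ 1` raises the model-based `3 X3` to `6 p² X3`.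
    have d9 : 0 ≤ c.α (k + 1) * (1 / 4 * X1 ω + 6 * p ^ 2 * X2 ω + 3 * X3 ω) := by positivity
    have d10 : 0 ≤ c.α (k + 1) * ((p ^ 2 - 1) * (6 * X3 ω)) :=
      mul_nonneg h0 (mul_nonneg (sub_nonneg.2 hp2) (by positivity))
    rw [c.direction_succ]
    linarith
  have hle := integral_mono_ae (h.integrable_norm_direction_sq he (k + 1))
    (((((i1.const_mul _).add (i2.const_mul _)).add (i3.const_mul _)).add (i4.const_mul _)).add
      (integrable_const _)) hpt
  refine hle.trans (le_of_eq ?_)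
  rw [integral_add' ((((i1.const_mul _).add (i2.const_mul _)).add (i3.const_mul _)).add
      (i4.const_mul _)) (integrable_const _),
    integral_add' (((i1.const_mul _).add (i2.const_mul _)).add (i3.const_mul _)) (i4.const_mul _),
    integral_add' ((i1.const_mul _).add (i2.const_mul _)) (i3.const_mul _),
    integral_add' (i1.const_mul _) (i2.const_mul _)]
  simp only [integral_const_mul, integral_const]
  simp
  ring

end IsClosedLoop

/-! ### Deterministic summation and arithmetic of the parameters. -/

/-- Summing a contractive recursion. -/
theorem sum_le_of_recursion {S x y : ℕ → ℝ} (hS : ∀ k, 0 ≤ S k) (hx : ∀ k, 0 ≤ x k)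
    (hy : ∀ k, 0 ≤ y k) (hrec : ∀ k, S (k + 1) ≤ 1 / 4 * S k + x k + y (k + 1)) (n : ℕ) :
    ∑ k ∈ Finset.range n, S k ≤
      4 / 3 * (S 0 + ∑ k ∈ Finset.range n, x k + ∑ k ∈ Finset.range n, y k) := by
  cases n with
  | zero => simpa using hS 0
  | succ n =>
    have h1 : ∑ k ∈ Finset.range n, S (k + 1) ≤ 1 / 4 * ∑ k ∈ Finset.range n, S k
        + ∑ k ∈ Finset.range n, x k + ∑ k ∈ Finset.range n, y (k + 1) := by
      rw [Finset.mul_sum, ← Finset.sum_add_distrib, ← Finset.sum_add_distrib]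
      exact Finset.sum_le_sum fun k _ => hrec k
    have h2 := Finset.sum_range_succ S n
    have h3 := Finset.sum_range_succ' S n
    have h4 := Finset.sum_range_succ x n
    have h5 := Finset.sum_range_succ' y n
    -- Enlarging the sum on the right by `S n` moves a quarter of the total to the left; 4/3 is the
    -- inverse of 3/4.
    linarith [hS n, hx n, hy 0]

theorem maxStep_eq (L : ℝ≥0) (p T : ℕ) :
    maxStep L p T = 1 / (224 * L * (p : ℝ) ^ 2 * (T : ℝ) ^ (1 / 3 : ℝ)) := rfl

theorem rpow_two_thirds {x : ℝ} (hx : 0 ≤ x) : x ^ (2 / 3 : ℝ) = (x ^ (1 / 3 : ℝ)) ^ 2 := by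
  rw [← Real.rpow_natCast, ← Real.rpow_mul hx]
  norm_num

theorem rpow_five_thirds {x : ℝ} (hx : 0 < x) :
    x ^ (5 / 3 : ℝ) = (x ^ (1 / 3 : ℝ)) ^ 2 * x := by
  rw [← rpow_two_thirds hx.le, ← Real.rpow_add_one hx.ne']
  norm_num

theorem rpow_one_third_pow_three {x : ℝ} (hx : 0 ≤ x) : (x ^ (1 / 3 : ℝ)) ^ 3 = x := by
  rw [← Real.rpow_natCast, ← Real.rpow_mul hx]
  norm_num

theorem smoothingParameter_sq {L M : ℝ≥0} (hL : 0 < L) (T : ℕ) :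
    (L * smoothingParameter L M T) ^ 2 =
      2 * (M : ℝ) ^ 2 / (112 ^ 2 * ((T : ℝ) ^ (1 / 3 : ℝ)) ^ 2) := by
  have hL' : (L : ℝ) ≠ 0 := by exact_mod_cast hL.ne'
  have h1 : L * smoothingParameter L M T = Real.sqrt 2 * M / (112 * (T : ℝ) ^ (1 / 3 : ℝ)) := by
    rw [smoothingParameter]
    field_simp
  rw [h1, div_pow, mul_pow, mul_pow, Real.sq_sqrt (by norm_num)]

theorem smoothingParameter_pos {L M : ℝ≥0} (hL : 0 < L) (hM : 0 < M) {T : ℕ} (hT : 0 < T) :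
    0 < smoothingParameter L M T := by
  have hL' : (0 : ℝ) < L := by exact_mod_cast hL
  have hM' : (0 : ℝ) < M := by exact_mod_cast hM
  have hT' : (0 : ℝ) < T := by exact_mod_cast hT
  rw [smoothingParameter]
  positivity

theorem maxStep_pos {L : ℝ≥0} (hL : 0 < L) {p T : ℕ} (hp : 0 < p) (hT : 0 < T) :
    0 < maxStep L p T := by
  have hL' : (0 : ℝ) < L := by exact_mod_cast hL
  have hp' : (0 : ℝ) < p := by exact_mod_cast hp
  have hT' : (0 : ℝ) < T := by exact_mod_cast hT
  rw [maxStep]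
  positivity

/-- The step size makes the second-moment recursion contractive. -/
theorem eight_mul_step_sq_le {L M : ℝ≥0} (hL : 0 < L) (hM : 0 < M) {p T : ℕ} (hp : 0 < p)
    (hT : 0 < T) {η : ℝ} (hη : 0 ≤ η) (hη' : η ≤ maxStep L p T) :
    8 * (η * (p * M / smoothingParameter L M T)) ^ 2 ≤ 1 := by
  have hL' : (0 : ℝ) < L := by exact_mod_cast hL
  have hM' : (0 : ℝ) < M := by exact_mod_cast hM
  have hp' : (1 : ℝ) ≤ p := by exact_mod_cast hp
  have hT' : (0 : ℝ) < T := by exact_mod_cast hT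
  have hδ := smoothingParameter_pos hL hM hT
  -- `δ` is proportional to `M / (L T^{1/3})` exactly so that `L`, `M` and `T` cancel in this ratio.
  have h1 : maxStep L p T * (p * M / smoothingParameter L M T) = 1 / (2 * Real.sqrt 2 * p) := by
    rw [maxStep, smoothingParameter]
    have : (T : ℝ) ^ (1 / 3 : ℝ) ≠ 0 := by positivity
    field_simp
    norm_num
  have h2 : η * (p * M / smoothingParameter L M T) ≤ 1 / (2 * Real.sqrt 2 * p) := by
    rw [← h1]
    gcongr
  calc 8 * (η * (p * M / smoothingParameter L M T)) ^ 2
      ≤ 8 * (1 / (2 * Real.sqrt 2 * p)) ^ 2 := by gcongr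
    _ = 1 / (p : ℝ) ^ 2 := by
        rw [div_pow, mul_pow, mul_pow, Real.sq_sqrt (by norm_num)]
        ring
    _ ≤ 1 := by
        rw [div_le_one (by positivity)]
        exact one_le_pow₀ hp'

/-- Absorbing the second moments of the update directions into the sum of squared gradients. -/
theorem sum_sq_gradient_le_of_descent {η L p t gap A E B D A' S S₀ : ℝ} (hη : 0 < η)
    (hp : 1 ≤ p) (ht : 1 ≤ t) (hL : 0 < L) (hstep : η ≤ 1 / (224 * L * p ^ 2 * t)) (hA : 0 ≤ A)
    (hE : 0 ≤ E) (hB : 0 ≤ B) (hD : 0 ≤ D) (hA' : 0 ≤ A') (hS₀ : 0 ≤ S₀)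
    (hdesc : η * (7 / 20 * A) ≤
      gap + η * (5 / 6 * E + 5 / 7 * (D * B) + 5 / 52 * (p ^ 2 * D * A')) + L / 2 * η ^ 2 * S)
    (hS : S ≤ 4 / 3 * (S₀ + 6 * p ^ 2 * A +
      (6 * p ^ 2 * A + 3 * (E + D * B) + 6 * p ^ 2 * D * A'))) :
    A ≤ 4 * gap / η + 5 * E + 4 * (D * B) + p ^ 2 * D * A' / 2 + S₀ / (84 * p ^ 2 * t) := by
  have hp0 : 0 < p := by linarith
  have ht0 : 0 < t := by linarith
  have hl : L * η * (224 * p ^ 2 * t) ≤ 1 := by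
    rw [le_div_iff₀ (by positivity)] at hstep
    linarith
  have hl1 : L * η * (224 * p ^ 2) ≤ 1 := by
    refine le_trans (mul_le_mul_of_nonneg_left ?_ (by positivity)) hl
    exact le_mul_of_one_le_right (by positivity) ht
  have hl2 : L * η * 224 ≤ 1 := by
    refine le_trans (mul_le_mul_of_nonneg_left ?_ (by positivity)) hl1
    exact le_mul_of_one_le_right (by positivity) (one_le_pow₀ hp)
  have hs0 : L * η * S₀ ≤ S₀ / (224 * p ^ 2 * t) := by
    rw [le_div_iff₀ (by positivity)]
    calc L * η * S₀ * (224 * p ^ 2 * t) = L * η * (224 * p ^ 2 * t) * S₀ := by ring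
      _ ≤ 1 * S₀ := by gcongr
      _ = S₀ := one_mul _
  have hdesc' : 7 / 20 * A ≤ gap / η + (5 / 6 * E + 5 / 7 * (D * B) + 5 / 52 * (p ^ 2 * D * A'))
      + L * η / 2 * S := by
    refine le_of_mul_le_mul_left ?_ hη
    have : η * (gap / η) = gap := by field_simp
    linear_combination hdesc - this
  have hSS : L * η / 2 * S ≤ L * η / 2 * (4 / 3 * (S₀ + 6 * p ^ 2 * A +
      (6 * p ^ 2 * A + 3 * (E + D * B) + 6 * p ^ 2 * D * A'))) := by gcongr
  -- The second moments cost at most `8Lηp² A ≤ A/28`, and `7/20 - 1/28 > 1/4`, whence the factor 4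
  -- in the conclusion. The `S₀` term receives `4 · (1/2) · (4/3) = 8/3`, and `224 · 3/8 = 84`.
  have e1 : L * η * (224 * p ^ 2) * A ≤ 1 * A := by gcongr
  have e2 : L * η * 224 * (E + D * B) ≤ 1 * (E + D * B) := by gcongr
  have e3 : L * η * 224 * (p ^ 2 * D * A') ≤ 1 * (p ^ 2 * D * A') := by gcongr
  have e4 : S₀ / (84 * p ^ 2 * t) = 8 / 3 * (S₀ / (224 * p ^ 2 * t)) := by
    ring
  have e5 : 4 * gap / η = 4 * (gap / η) := by ring
  have e6 : 0 ≤ D * B := by positivity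
  have e7 : 0 ≤ p ^ 2 * D * A' := by positivity
  rw [e4, e5]
  linarith

/-! ### The explicit bound over the horizon. -/

namespace IsClosedLoop

variable {Ω : Type*} [m : MeasurableSpace Ω] {p q r : ℕ} {μ : Measure Ω} [IsProbabilityMeasure μ]
  {ℱ : Filtration ℕ m} {v : Ω → ℕ → Vec p} {H : Ω → ℕ → Vec p →L[ℝ] Vec q}
  {P : SteadyStateProblem p q r} {c : GrayBoxController p} {L M MΦ : ℝ≥0}

/-- The expected decrease of the reduced objective, summed over the horizon. -/
theorem sum_descent_le (h : IsClosedLoop μ ℱ v H P c L M MΦ)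
    (he : SquareIntegrableError μ v H P c) (T : ℕ) :
    c.η * (7 / 20 * ∑ k ∈ Finset.range T,
        ∫ ω, ‖∇ P.reduced (c.candidate P (H ω) (v ω) k)‖ ^ 2 ∂μ) ≤
      (∫ ω, P.reduced (c.candidate P (H ω) (v ω) 0) ∂μ) - P.optimalValue
      + c.η * (5 / 6 * (MΦ ^ 2 * ∑ k ∈ Finset.range T,
            c.α k * ∫ ω, c.sensitivityError P (H ω) (v ω) k ^ 2 ∂μ)
          + 5 / 7 * ((L * c.δ) ^ 2 * ∑ k ∈ Finset.range T, c.α k)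
          + 5 / 52 * (p ^ 2 * (L * c.δ) ^ 2 * ∑ k ∈ Finset.range T, (1 - c.α k)))
      + L / 2 * c.η ^ 2 *
        ∑ k ∈ Finset.range T, ∫ ω, ‖c.direction P (H ω) (v ω) k‖ ^ 2 ∂μ := by
  have hlow : P.optimalValue ≤ ∫ ω, P.reduced (c.candidate P (H ω) (v ω) T) ∂μ := by
    have := integral_mono (μ := μ) (integrable_const P.optimalValue)
      (h.integrable_reduced_candidate he T) fun ω => h.regular.optimalValue_le _
    simpa using this
  have hind : ∀ n : ℕ, c.η * (7 / 20 * ∑ k ∈ Finset.range n,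
        ∫ ω, ‖∇ P.reduced (c.candidate P (H ω) (v ω) k)‖ ^ 2 ∂μ) ≤
      (∫ ω, P.reduced (c.candidate P (H ω) (v ω) 0) ∂μ)
        - (∫ ω, P.reduced (c.candidate P (H ω) (v ω) n) ∂μ)
      + c.η * (5 / 6 * (MΦ ^ 2 * ∑ k ∈ Finset.range n,
            c.α k * ∫ ω, c.sensitivityError P (H ω) (v ω) k ^ 2 ∂μ)
          + 5 / 7 * ((L * c.δ) ^ 2 * ∑ k ∈ Finset.range n, c.α k)
          + 5 / 52 * (p ^ 2 * (L * c.δ) ^ 2 * ∑ k ∈ Finset.range n, (1 - c.α k)))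
      + L / 2 * c.η ^ 2 *
        ∑ k ∈ Finset.range n, ∫ ω, ‖c.direction P (H ω) (v ω) k‖ ^ 2 ∂μ := by
    intro n
    induction n with
    | zero => simp
    | succ n ih =>
      have := h.integral_reduced_succ_le he n
      simp only [Finset.sum_range_succ]
      linarith
  linarith [hind T]

/-- The second moments of the update directions, summed over the horizon. -/
theorem sum_norm_direction_sq_le (h : IsClosedLoop μ ℱ v H P c L M MΦ)
    (he : SquareIntegrableError μ v H P c) (hstep : 8 * (c.η * (p * M / c.δ)) ^ 2 ≤ 1) (T : ℕ) :
    ∑ k ∈ Finset.range T, ∫ ω, ‖c.direction P (H ω) (v ω) k‖ ^ 2 ∂μ ≤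
      4 / 3 * ((∫ ω, ‖c.direction P (H ω) (v ω) 0‖ ^ 2 ∂μ)
        + 6 * p ^ 2 * (∑ k ∈ Finset.range T,
          ∫ ω, ‖∇ P.reduced (c.candidate P (H ω) (v ω) k)‖ ^ 2 ∂μ)
        + (6 * p ^ 2 * (∑ k ∈ Finset.range T,
            ∫ ω, ‖∇ P.reduced (c.candidate P (H ω) (v ω) k)‖ ^ 2 ∂μ)
          + 3 * (MΦ ^ 2 * (∑ k ∈ Finset.range T,
              c.α k * ∫ ω, c.sensitivityError P (H ω) (v ω) k ^ 2 ∂μ)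
            + (L * c.δ) ^ 2 * ∑ k ∈ Finset.range T, c.α k)
          + 6 * p ^ 2 * (L * c.δ) ^ 2 * ∑ k ∈ Finset.range T, (1 - c.α k))) := by
  have hα := h.coeff_mem
  have hpos : ∀ f : Ω → ℝ, 0 ≤ ∫ ω, f ω ^ 2 ∂μ := fun f => integral_nonneg fun ω => sq_nonneg _
  refine (sum_le_of_recursion (S := fun k => ∫ ω, ‖c.direction P (H ω) (v ω) k‖ ^ 2 ∂μ)
    (x := fun k => 6 * p ^ 2 * ∫ ω, ‖∇ P.reduced (c.candidate P (H ω) (v ω) k)‖ ^ 2 ∂μ)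
    (y := fun k => 6 * p ^ 2 * ∫ ω, ‖∇ P.reduced (c.candidate P (H ω) (v ω) k)‖ ^ 2 ∂μ
          + 3 * c.α k *
              (MΦ ^ 2 * ∫ ω, c.sensitivityError P (H ω) (v ω) k ^ 2 ∂μ + (L * c.δ) ^ 2)
          + (1 - c.α k) * (6 * p ^ 2 * (L * c.δ) ^ 2))
    (fun k => hpos _) (fun k => mul_nonneg (by positivity) (hpos _))
    (fun k => ?_) (h.integral_norm_direction_succ_sq_le he hstep) T).trans (le_of_eq ?_)
  · have h1 := (hα k).1
    have h2 := sub_nonneg.2 (hα k).2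
    have h3 := hpos fun ω => ‖∇ P.reduced (c.candidate P (H ω) (v ω) k)‖
    have h4 := hpos fun ω => c.sensitivityError P (H ω) (v ω) k
    positivity
  · have hsum : ∀ y : ℕ → ℝ, ∑ k ∈ Finset.range T, 3 * c.α k * (MΦ ^ 2 * y k + (L * c.δ) ^ 2) =
        3 * (MΦ ^ 2 * (∑ k ∈ Finset.range T, c.α k * y k)
          + (L * c.δ) ^ 2 * ∑ k ∈ Finset.range T, c.α k) := by
      intro y
      simp only [Finset.mul_sum, ← Finset.sum_add_distrib]
      exact Finset.sum_congr rfl fun k _ => by ring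
    rw [Finset.sum_add_distrib, Finset.sum_add_distrib, hsum, ← Finset.sum_mul, ← Finset.mul_sum]
    ring

/-- The explicit bound with the sharp dependence on the first update direction. -/
theorem averageSqGradient_le (h : IsClosedLoop μ ℱ v H P c L M MΦ)
    (he : SquareIntegrableError μ v H P c) {T : ℕ} (hT : 0 < T) (hL : 0 < L) (hM : 0 < M)
    (hη : c.η ≤ maxStep L p T) (hδ : c.δ = smoothingParameter L M T) :
    averageSqGradient μ c P H v T ≤
      4 * ((∫ ω, P.reduced (c.candidate P (H ω) (v ω) 0) ∂μ) - P.optimalValue) / (c.η * T)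
      + (5 * (MΦ : ℝ) ^ 2 / T * ∑ k ∈ Finset.range T,
            c.α k * ∫ ω, c.sensitivityError P (H ω) (v ω) k ^ 2 ∂μ
          + (M : ℝ) ^ 2 / (112 ^ 2 * (T : ℝ) ^ (5 / 3 : ℝ)) * ∑ k ∈ Finset.range T,
              (8 * c.α k + (p : ℝ) ^ 2 * (1 - c.α k))
          + (∫ ω, ‖c.direction P (H ω) (v ω) 0‖ ^ 2 ∂μ)
              / (84 * (p : ℝ) ^ 2 * (T : ℝ) ^ (1 / 3 : ℝ)) / T) := by
  have hT0 : (0 : ℝ) < T := by exact_mod_cast hT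
  have hT1 : (1 : ℝ) ≤ T := by exact_mod_cast hT
  have hp1 : (1 : ℝ) ≤ p := by exact_mod_cast h.dim_pos
  have hL0 : (0 : ℝ) < L := by exact_mod_cast hL
  have hα := h.coeff_mem
  have hpos : ∀ f : Ω → ℝ, 0 ≤ ∫ ω, f ω ^ 2 ∂μ := fun f => integral_nonneg fun ω => sq_nonneg _
  set t := (T : ℝ) ^ (1 / 3 : ℝ) with ht
  have ht1 : 1 ≤ t := Real.one_le_rpow hT1 (by norm_num)
  have hstep := eight_mul_step_sq_le hL hM h.dim_pos hT h.step_pos.le hη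
  rw [← hδ] at hstep
  have hη' := hη
  rw [maxStep_eq] at hη'
  have key := sum_sq_gradient_le_of_descent h.step_pos hp1 ht1 hL0 hη'
    (Finset.sum_nonneg fun k _ => hpos _)
    (mul_nonneg (by positivity)
      (Finset.sum_nonneg fun k _ => mul_nonneg (hα k).1 (hpos _)))
    (Finset.sum_nonneg fun k _ => (hα k).1) (sq_nonneg _)
    (Finset.sum_nonneg fun k _ => sub_nonneg.2 (hα k).2) (hpos _)
    (h.sum_descent_le he T) (h.sum_norm_direction_sq_le he hstep T)
  have h53 : (T : ℝ) ^ (5 / 3 : ℝ) = t ^ 2 * T := rpow_five_thirds hT0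
  have hD : (L * c.δ) ^ 2 = 2 * (M : ℝ) ^ 2 / (112 ^ 2 * t ^ 2) := by
    rw [hδ, smoothingParameter_sq hL]
  rw [hD] at key
  have hsum : ∑ k ∈ Finset.range T, (8 * c.α k + (p : ℝ) ^ 2 * (1 - c.α k)) =
      8 * ∑ k ∈ Finset.range T, c.α k + p ^ 2 * ∑ k ∈ Finset.range T, (1 - c.α k) := by
    rw [Finset.sum_add_distrib, Finset.mul_sum, Finset.mul_sum]
  rw [averageSqGradient, hsum, h53, one_div, inv_mul_le_iff₀ hT0]
  refine key.trans (le_of_eq ?_)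
  have hη0 := h.step_pos
  field_simp
  ring

end IsClosedLoop

/-! ### Convergence rates. -/

theorem sum_inv_rpow_two_thirds_le (T : ℕ) :
    ∑ k ∈ Finset.range T, 1 / ((k : ℝ) + 1) ^ (2 / 3 : ℝ) ≤ 3 * (T : ℝ) ^ (1 / 3 : ℝ) := by
  induction T with
  | zero => simp
  | succ n ih =>
    rw [Finset.sum_range_succ]
    push_cast
    have hn : (0 : ℝ) ≤ n := n.cast_nonneg
    have hn' : (0 : ℝ) < n + 1 := by positivity
    have ha := rpow_one_third_pow_three hn
    have hb := rpow_one_third_pow_three hn'.le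
    have hab : (n : ℝ) ^ (1 / 3 : ℝ) ≤ ((n : ℝ) + 1) ^ (1 / 3 : ℝ) := by gcongr; linarith
    have ha0 : 0 ≤ (n : ℝ) ^ (1 / 3 : ℝ) := by positivity
    have hb0 : 0 < ((n : ℝ) + 1) ^ (1 / 3 : ℝ) := by positivity
    rw [rpow_two_thirds hn'.le]
    set a := (n : ℝ) ^ (1 / 3 : ℝ)
    set b := ((n : ℝ) + 1) ^ (1 / 3 : ℝ)
    -- With `a³ = n` and `b³ = n + 1`, this is `b³ - a³ ≤ 3b²(b - a)`; the difference of the two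
    -- sides is `(b - a)²(2b + a)`. The right-hand side telescopes.
    have h1 : 1 / b ^ 2 ≤ 3 * (b - a) := by
      rw [div_le_iff₀ (by positivity)]
      have : 0 ≤ (b - a) * ((b - a) * (2 * b + a)) :=
        mul_nonneg (sub_nonneg.2 hab) (mul_nonneg (sub_nonneg.2 hab) (by positivity))
      linarith
    linarith

/-- The constant in the convergence rate. -/
noncomputable def rateConstant (L M MΦ : ℝ≥0) (C ε κ Δ D : ℝ) : ℝ :=
  896 * L * |Δ| / κ + 15 * MΦ ^ 2 * (C * ε ^ 2) + 9 * M ^ 2 / 112 ^ 2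
    + (12 * M ^ 2 + 3 * MΦ ^ 2 * ε ^ 2 + 18816 * (L * D) ^ 2) / 84 + 1

theorem rateConstant_pos (L M MΦ : ℝ≥0) {C ε κ : ℝ} (Δ D : ℝ) (hC : 0 < C) (hκ : 0 < κ) :
    0 < rateConstant L M MΦ C ε κ Δ D := by
  rw [rateConstant]
  positivity

theorem GrayBoxController.sensitivityError_nonneg {p q r : ℕ} (c : GrayBoxController p)
    (P : SteadyStateProblem p q r) (H : ℕ → Vec p →L[ℝ] Vec q) (v : ℕ → Vec p) (k : ℕ) :
    0 ≤ c.sensitivityError P H v k :=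
  norm_nonneg _

namespace IsClosedLoop

variable {Ω : Type*} [m : MeasurableSpace Ω] {p q r : ℕ} {μ : Measure Ω} [IsProbabilityMeasure μ]
  {ℱ : Filtration ℕ m} {v : Ω → ℕ → Vec p} {H : Ω → ℕ → Vec p →L[ℝ] Vec q}
  {P : SteadyStateProblem p q r} {c : GrayBoxController p} {L M MΦ : ℝ≥0}

theorem integrable_sensitivityError_sq (h : IsClosedLoop μ ℱ v H P c L M MΦ) {k : ℕ} {b : ℝ}
    (hb : ∀ᵐ ω ∂μ, c.sensitivityError P (H ω) (v ω) k ≤ b) :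
    Integrable (fun ω => c.sensitivityError P (H ω) (v ω) k ^ 2) μ := by
  refine Integrable.of_bound (C := b ^ 2)
    ((h.measurable_sensitivityError k).pow_const 2).aestronglyMeasurable ?_
  filter_upwards [hb] with ω hω
  have := c.sensitivityError_nonneg P (H ω) (v ω) k
  rw [norm_pow, Real.norm_eq_abs, abs_of_nonneg this]
  gcongr

theorem integral_sensitivityError_sq_le (h : IsClosedLoop μ ℱ v H P c L M MΦ) {k : ℕ} {b : ℝ}
    (hb : ∀ᵐ ω ∂μ, c.sensitivityError P (H ω) (v ω) k ≤ b) :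
    ∫ ω, c.sensitivityError P (H ω) (v ω) k ^ 2 ∂μ ≤ b ^ 2 := by
  have := integral_mono_ae (g := fun _ => b ^ 2) (h.integrable_sensitivityError_sq hb)
    (integrable_const (b ^ 2)) (by
      filter_upwards [hb] with ω hω
      have := c.sensitivityError_nonneg P (H ω) (v ω) k
      gcongr)
  simpa using this

/-- Second moment of the first update direction. -/
theorem integral_norm_direction_zero_sq_le (h : IsClosedLoop μ ℱ v H P c L M MΦ) {b D : ℝ}
    (hb : ∀ᵐ ω ∂μ, c.sensitivityError P (H ω) (v ω) 0 ≤ b) (hD : ‖c.w₀ - c.uInit‖ ≤ D) :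
    ∫ ω, ‖c.direction P (H ω) (v ω) 0‖ ^ 2 ∂μ ≤
      12 * p ^ 2 * M ^ 2 + 3 * MΦ ^ 2 * b ^ 2 + 3 * p ^ 2 * (M / c.δ * D) ^ 2 := by
  have hp1 : (1 : ℝ) ≤ p := by exact_mod_cast h.dim_pos
  have hδ := h.smoothing_pos
  have hD0 : 0 ≤ D := (norm_nonneg _).trans hD
  have hpt : ∀ᵐ ω ∂μ, ‖c.direction P (H ω) (v ω) 0‖ ^ 2 ≤
      12 * p ^ 2 * M ^ 2 + 3 * MΦ ^ 2 * b ^ 2 + 3 * p ^ 2 * (M / c.δ * D) ^ 2 := by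
    filter_upwards [h.ae_norm_exploration, hb] with ω hω hbω
    have h0 := c.sensitivityError_nonneg P (H ω) (v ω) 0
    have h1 : ‖c.direction P (H ω) (v ω) 0‖ ≤ 2 * (p * M) + MΦ * b + p * (M / c.δ * D) := by
      have h2 : ‖c.direction P (H ω) (v ω) 0‖ ≤ M + MΦ * c.sensitivityError P (H ω) (v ω) 0
          + p * M / c.δ * (‖c.w₀ - c.uInit‖ + c.δ) := h.norm_direction_le (hω 0)
      calc _ ≤ M + MΦ * b + p * M / c.δ * (D + c.δ) := by
            refine h2.trans ?_
            gcongr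
        _ = M + MΦ * b + p * (M / c.δ * D) + p * M := by
            field_simp
            ring
        _ ≤ _ := by nlinarith [M.coe_nonneg]
    calc _ ≤ (2 * (p * M) + MΦ * b + p * (M / c.δ * D)) ^ 2 := by gcongr
      _ ≤ 3 * ((2 * (p * M)) ^ 2 + (MΦ * b) ^ 2 + (p * (M / c.δ * D)) ^ 2) := by
          linarith [sq_nonneg (2 * (p * M) - MΦ * b), sq_nonneg (2 * (p * M) - p * (M / c.δ * D)),
            sq_nonneg (MΦ * b - p * (M / c.δ * D))]
      _ = _ := by ring
  have := integral_mono_of_nonneg (f := fun ω => ‖c.direction P (H ω) (v ω) 0‖ ^ 2)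
    (ae_of_all μ fun ω => sq_nonneg _) (integrable_const _) hpt
  simpa using this

/-- Convergence rate when the coefficients are balanced against the sensitivity errors. -/
theorem averageSqGradient_rate (h : IsClosedLoop μ ℱ v H P c L M MΦ) {T : ℕ} (hT : 0 < T)
    (hL : 0 < L) (hM : 0 < M) {C ε κ Δ D : ℝ} (hC : 0 < C) (hκ : 0 < κ)
    (hΔ : P.reduced c.w₀ - P.optimalValue ≤ Δ) (hD : ‖c.w₀ - c.uInit‖ ≤ D)
    (hκη : κ * maxStep L p T ≤ c.η) (hη : c.η ≤ maxStep L p T)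
    (hδ : c.δ = smoothingParameter L M T) {b : ℕ → ℝ}
    (hb : ∀ k, ∀ᵐ ω ∂μ, c.sensitivityError P (H ω) (v ω) k ≤ b k) (hb0 : b 0 = ε)
    (hαb : ∀ k, c.α k * b k ^ 2 ≤ C * ε ^ 2 * (1 / ((k : ℝ) + 1) ^ (2 / 3 : ℝ))) :
    averageSqGradient μ c P H v T ≤
      rateConstant L M MΦ C ε κ Δ D * ((p : ℝ) ^ 2 / (T : ℝ) ^ (2 / 3 : ℝ)) := by
  have hT0 : (0 : ℝ) < T := by exact_mod_cast hT
  have hT1 : (1 : ℝ) ≤ T := by exact_mod_cast hT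
  have hp1 : (1 : ℝ) ≤ p := by exact_mod_cast h.dim_pos
  have hp2 : (1 : ℝ) ≤ (p : ℝ) ^ 2 := one_le_pow₀ hp1
  have hL0 : (0 : ℝ) < L := by exact_mod_cast hL
  have hM0 : (0 : ℝ) < M := by exact_mod_cast hM
  have hδ0 := h.smoothing_pos
  have hα := h.coeff_mem
  have ht1 : 1 ≤ (T : ℝ) ^ (1 / 3 : ℝ) := Real.one_le_rpow hT1 (by norm_num)
  have ht3 := rpow_one_third_pow_three hT0.le
  have key := h.averageSqGradient_le (fun k => h.integrable_sensitivityError_sq (hb k)) hT hL hM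
    hη hδ
  have hdir := h.integral_norm_direction_zero_sq_le (hb 0) hD
  rw [hb0] at hdir
  have hF0 : ∫ ω, P.reduced (c.candidate P (H ω) (v ω) 0) ∂μ = P.reduced c.w₀ := by
    simp [GrayBoxController.candidate, GrayBoxController.state]
  have hgap := sub_nonneg.2 (h.regular.optimalValue_le c.w₀)
  have hΔ0 := hgap.trans hΔ
  have hE : ∑ k ∈ Finset.range T, c.α k * ∫ ω, c.sensitivityError P (H ω) (v ω) k ^ 2 ∂μ ≤
      C * ε ^ 2 * (3 * (T : ℝ) ^ (1 / 3 : ℝ)) := by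
    refine le_trans ?_ (mul_le_mul_of_nonneg_left (sum_inv_rpow_two_thirds_le T)
      (by positivity : 0 ≤ C * ε ^ 2))
    rw [Finset.mul_sum]
    refine Finset.sum_le_sum fun k _ => le_trans ?_ (hαb k)
    exact mul_le_mul_of_nonneg_left (h.integral_sensitivityError_sq_le (hb k)) (hα k).1
  have hA : ∑ k ∈ Finset.range T, (8 * c.α k + (p : ℝ) ^ 2 * (1 - c.α k)) ≤
      (T : ℝ) * (9 * (p : ℝ) ^ 2) := by
    have : ∀ k ∈ Finset.range T, 8 * c.α k + (p : ℝ) ^ 2 * (1 - c.α k) ≤ 9 * p ^ 2 := by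
      intro k _
      obtain ⟨h0, h1⟩ := hα k
      have := mul_nonneg h0 (sq_nonneg (p : ℝ))
      linarith
    simpa using Finset.sum_le_sum this
  -- From `M/δ = 112 L t / √2` with `t = T^{1/3}`, and `112²/2 = 6272`.
  have hMδ : (M / c.δ * D) ^ 2 = 6272 * (L * D) ^ 2 * ((T : ℝ) ^ (1 / 3 : ℝ)) ^ 2 := by
    have h1 := smoothingParameter_sq (M := M) hL T
    rw [← hδ] at h1
    have h2 : (M / c.δ * D) ^ 2 = (L * D) ^ 2 * M ^ 2 / (L * c.δ) ^ 2 := by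
      field_simp
    rw [h2, h1]
    field_simp
    ring
  have hgapη : 4 * (P.reduced c.w₀ - P.optimalValue) / (c.η * T) ≤
      4 * |Δ| / (κ * maxStep L p T * T) := by
    have := maxStep_pos hL h.dim_pos hT
    gcongr
    exact hΔ.trans (le_abs_self Δ)
  rw [hF0] at key
  rw [hMδ] at hdir
  rw [maxStep_eq] at hgapη
  rw [rpow_five_thirds hT0] at key
  rw [rpow_two_thirds hT0.le]
  set t := (T : ℝ) ^ (1 / 3 : ℝ) with ht
  have ht0 : 0 < t := by linarith
  have b1 : 4 * |Δ| / (κ * (1 / (224 * L * (p : ℝ) ^ 2 * t)) * T) =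
      896 * L * |Δ| / κ * (p ^ 2 / t ^ 2) := by
    rw [← ht3]
    field_simp
    ring
  have b2 : 5 * (MΦ : ℝ) ^ 2 / T * ∑ k ∈ Finset.range T,
      c.α k * ∫ ω, c.sensitivityError P (H ω) (v ω) k ^ 2 ∂μ ≤
      15 * MΦ ^ 2 * (C * ε ^ 2) * (p ^ 2 / t ^ 2) := by
    calc _ ≤ 5 * (MΦ : ℝ) ^ 2 / T * (C * ε ^ 2 * (3 * t)) := by gcongr
      _ = 15 * MΦ ^ 2 * (C * ε ^ 2) * (1 / t ^ 2) := by
          rw [← ht3]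
          field_simp
          ring
      _ ≤ _ := by gcongr
  have b3 : (M : ℝ) ^ 2 / (112 ^ 2 * (t ^ 2 * T)) *
      ∑ k ∈ Finset.range T, (8 * c.α k + (p : ℝ) ^ 2 * (1 - c.α k)) ≤
      9 * M ^ 2 / 112 ^ 2 * (p ^ 2 / t ^ 2) := by
    calc _ ≤ (M : ℝ) ^ 2 / (112 ^ 2 * (t ^ 2 * T)) * (T * (9 * p ^ 2)) := by gcongr
      _ = _ := by field_simp
  -- The first direction may have second moment of order `p² t²`, since `1/δ` grows like `t`. The
  -- denominator `84 p² t` kept in `averageSqGradient_le` compensates; a bare division by `T = t³`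
  -- would only give `p²/t`.
  have b4 : (∫ ω, ‖c.direction P (H ω) (v ω) 0‖ ^ 2 ∂μ) / (84 * (p : ℝ) ^ 2 * t) / T ≤
      (12 * M ^ 2 + 3 * MΦ ^ 2 * ε ^ 2 + 18816 * (L * D) ^ 2) / 84 * (p ^ 2 / t ^ 2) := by
    have hpt : (1 : ℝ) ≤ p ^ 2 * t ^ 2 := one_le_mul_of_one_le_of_one_le hp2 (one_le_pow₀ ht1)
    have ht2 : (1 : ℝ) ≤ t ^ 2 := one_le_pow₀ ht1
    have hnum : ∫ ω, ‖c.direction P (H ω) (v ω) 0‖ ^ 2 ∂μ ≤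
        (12 * M ^ 2 + 3 * MΦ ^ 2 * ε ^ 2 + 18816 * (L * D) ^ 2) * (p ^ 2 * t ^ 2) := by
      have e1 : 12 * (p : ℝ) ^ 2 * M ^ 2 * 1 ≤ 12 * (p : ℝ) ^ 2 * M ^ 2 * t ^ 2 := by gcongr
      have e2 : 3 * (MΦ : ℝ) ^ 2 * ε ^ 2 * 1 ≤ 3 * (MΦ : ℝ) ^ 2 * ε ^ 2 * (p ^ 2 * t ^ 2) := by
        gcongr
      linarith
    calc _ ≤ (12 * M ^ 2 + 3 * MΦ ^ 2 * ε ^ 2 + 18816 * (L * D) ^ 2) * (p ^ 2 * t ^ 2)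
          / (84 * (p : ℝ) ^ 2 * t) / T := by gcongr
      _ = (12 * M ^ 2 + 3 * MΦ ^ 2 * ε ^ 2 + 18816 * (L * D) ^ 2) / 84 * (1 / t ^ 2) := by
          rw [← ht3]
          field_simp
      _ ≤ _ := by gcongr
  have hpt0 : 0 ≤ (p : ℝ) ^ 2 / t ^ 2 := by positivity
  rw [rateConstant]
  rw [b1] at hgapη
  linarith

end IsClosedLoop

/-- The coefficients `min (C / (k + 1) ^ s) 1` lie in the unit interval. -/
theorem min_div_rpow_mem_Icc {C : ℝ} (hC : 0 < C) (s : ℝ) (k : ℕ) :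
    min (C / ((k : ℝ) + 1) ^ s) 1 ∈ Set.Icc (0 : ℝ) 1 :=
  ⟨le_min (by positivity) zero_le_one, min_le_right _ _⟩

theorem theorem1 :
    -- explicit bound; the constant `C M s` is taken at `s = E ‖φ̃ 0‖²`
    (∃ C : ℝ → ℝ → ℝ, (∀ M s : ℝ, 0 < M → 0 ≤ s → 0 < C M s) ∧
      ∀ (L M MΦ : ℝ≥0) (p q r T : ℕ), 0 < L → 0 < M → 0 < p → 0 < T →
      ∀ (Ω : Type*) [m : MeasurableSpace Ω] (μ : Measure Ω) [IsProbabilityMeasure μ]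
        (ℱ : Filtration ℕ m) (v : Ω → ℕ → Vec p) (H : Ω → ℕ → Vec p →L[ℝ] Vec q)
        (P : SteadyStateProblem p q r) (c : GrayBoxController p),
      P.Regular L M MΦ → IsExploration μ ℱ v H →
      (∀ k, c.α k ∈ Set.Icc (0 : ℝ) 1) →
      0 < c.η → c.η ≤ maxStep L p T → c.δ = smoothingParameter L M T →
      (∀ k, Integrable (fun ω => c.sensitivityError P (H ω) (v ω) k ^ 2) μ) →
      let gap : ℝ := (∫ ω, P.reduced (c.candidate P (H ω) (v ω) 0) ∂μ) - P.optimalValue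
      let remainder : ℝ :=
        5 * (MΦ : ℝ) ^ 2 / T * ∑ k ∈ Finset.range T,
            c.α k * ∫ ω, c.sensitivityError P (H ω) (v ω) k ^ 2 ∂μ
          + (M : ℝ) ^ 2 / (112 ^ 2 * (T : ℝ) ^ (5 / 3 : ℝ)) * ∑ k ∈ Finset.range T,
              (8 * c.α k + (p : ℝ) ^ 2 * (1 - c.α k))
          + C M (∫ ω, ‖c.direction P (H ω) (v ω) 0‖ ^ 2 ∂μ) / T
      (∀ k, Integrable (fun ω => ‖∇ P.reduced (c.candidate P (H ω) (v ω) k)‖ ^ 2) μ) ∧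
      Integrable (fun ω => ‖c.direction P (H ω) (v ω) 0‖ ^ 2) μ ∧
      averageSqGradient μ c P H v T ≤ 4 * gap / (c.η * T) + remainder ∧
      (c.η = maxStep L p T →
        averageSqGradient μ c P H v T ≤
          896 * L * gap * ((p : ℝ) ^ 2 / (T : ℝ) ^ (2 / 3 : ℝ)) + remainder)) ∧
    -- rate, bounded sensitivity errors
    (∀ (L M MΦ : ℝ≥0) (C ε κ Δ D : ℝ), 0 < L → 0 < M → 0 < C → 0 < ε → 0 < κ → κ ≤ 1 →
      ∃ K : ℝ, 0 < K ∧
      ∀ (p q r T : ℕ), 0 < p → 0 < T →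
      ∀ (Ω : Type*) [m : MeasurableSpace Ω] (μ : Measure Ω) [IsProbabilityMeasure μ]
        (ℱ : Filtration ℕ m) (v : Ω → ℕ → Vec p) (H : Ω → ℕ → Vec p →L[ℝ] Vec q)
        (P : SteadyStateProblem p q r) (c : GrayBoxController p),
      P.Regular L M MΦ → IsExploration μ ℱ v H →
      P.reduced c.w₀ - P.optimalValue ≤ Δ → ‖c.w₀ - c.uInit‖ ≤ D →
      κ * maxStep L p T ≤ c.η → c.η ≤ maxStep L p T → c.δ = smoothingParameter L M T →
      (∀ k, c.α k = min (C / ((k : ℝ) + 1) ^ (2 / 3 : ℝ)) 1) →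
      (∀ k, ∀ᵐ ω ∂μ, c.sensitivityError P (H ω) (v ω) k ≤ ε) →
      (∀ k, Integrable (fun ω => ‖∇ P.reduced (c.candidate P (H ω) (v ω) k)‖ ^ 2) μ) ∧
      averageSqGradient μ c P H v T ≤ K * ((p : ℝ) ^ 2 / (T : ℝ) ^ (2 / 3 : ℝ))) ∧
    -- rate, decaying sensitivity errors
    (∀ (L M MΦ : ℝ≥0) (C ε θ κ Δ D : ℝ), 0 < L → 0 < M → 0 < C → 0 < ε →
      0 < θ → θ < 1 / 3 → 0 < κ → κ ≤ 1 →
      ∃ K : ℝ, 0 < K ∧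
      ∀ (p q r T : ℕ), 0 < p → 0 < T →
      ∀ (Ω : Type*) [m : MeasurableSpace Ω] (μ : Measure Ω) [IsProbabilityMeasure μ]
        (ℱ : Filtration ℕ m) (v : Ω → ℕ → Vec p) (H : Ω → ℕ → Vec p →L[ℝ] Vec q)
        (P : SteadyStateProblem p q r) (c : GrayBoxController p),
      P.Regular L M MΦ → IsExploration μ ℱ v H →
      P.reduced c.w₀ - P.optimalValue ≤ Δ → ‖c.w₀ - c.uInit‖ ≤ D →
      κ * maxStep L p T ≤ c.η → c.η ≤ maxStep L p T → c.δ = smoothingParameter L M T →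
      (∀ k, c.α k = min (C / ((k : ℝ) + 1) ^ (2 / 3 - 2 * θ)) 1) →
      (∀ k, ∀ᵐ ω ∂μ, c.sensitivityError P (H ω) (v ω) k ≤ ε / ((k : ℝ) + 1) ^ θ) →
      (∀ k, Integrable (fun ω => ‖∇ P.reduced (c.candidate P (H ω) (v ω) k)‖ ^ 2) μ) ∧
      averageSqGradient μ c P H v T ≤ K * ((p : ℝ) ^ 2 / (T : ℝ) ^ (2 / 3 : ℝ))) := by
  -- The first-direction term is at most `s/T`, as its extra denominator is at least 1; the added 1
  -- only makes the constant positive when `s = 0`.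
  refine ⟨⟨fun _ s => s + 1, fun M s _ hs => by linarith, ?_⟩, ?_, ?_⟩
  · intro L M MΦ p q r T hL hM hp hT Ω m μ _ ℱ v H P c hP hex hα hη hη' hδ he gap remainder
    have h : IsClosedLoop μ ℱ v H P c L M MΦ :=
      ⟨hp, hP, hex, hα, hη, hδ ▸ smoothingParameter_pos hL hM hT⟩
    have hT0 : (0 : ℝ) < T := by exact_mod_cast hT
    have hT1 : (1 : ℝ) ≤ T := by exact_mod_cast hT
    have hp1 : (1 : ℝ) ≤ p := by exact_mod_cast hp
    have hL0 : (0 : ℝ) < L := by exact_mod_cast hL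
    have hbound : averageSqGradient μ c P H v T ≤ 4 * gap / (c.η * T) + remainder := by
      refine (h.averageSqGradient_le he hT hL hM hη' hδ).trans ?_
      simp only [gap, remainder]
      have hS : 0 ≤ ∫ ω, ‖c.direction P (H ω) (v ω) 0‖ ^ 2 ∂μ :=
        integral_nonneg fun ω => sq_nonneg _
      have ht1 : 1 ≤ (T : ℝ) ^ (1 / 3 : ℝ) := Real.one_le_rpow hT1 (by norm_num)
      have hden : 1 ≤ 84 * (p : ℝ) ^ 2 * (T : ℝ) ^ (1 / 3 : ℝ) :=
        one_le_mul_of_one_le_of_one_le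
          (one_le_mul_of_one_le_of_one_le (by norm_num) (one_le_pow₀ hp1)) ht1
      gcongr
      exact (div_le_self hS hden).trans (by linarith)
    refine ⟨h.integrable_norm_gradient_sq, h.integrable_norm_direction_sq he 0, hbound,
      fun heq => hbound.trans (le_of_eq ?_)⟩
    rw [heq, maxStep_eq, rpow_two_thirds hT0.le]
    have ht0 : 0 < (T : ℝ) ^ (1 / 3 : ℝ) := by positivity
    have ht3 := rpow_one_third_pow_three hT0.le
    congr 1
    set t := (T : ℝ) ^ (1 / 3 : ℝ)
    rw [← ht3]
    field_simp
    ring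
  · intro L M MΦ C ε κ Δ D hL hM hC hε hκ _
    refine ⟨rateConstant L M MΦ C ε κ Δ D, rateConstant_pos L M MΦ Δ D hC hκ, ?_⟩
    intro p q r T hp hT Ω m μ _ ℱ v H P c hP hex hΔ hD hκη hη hδ hα hb
    have h : IsClosedLoop μ ℱ v H P c L M MΦ :=
      ⟨hp, hP, hex, fun k => hα k ▸ min_div_rpow_mem_Icc hC _ k,
        (mul_pos hκ (maxStep_pos hL hp hT)).trans_le hκη, hδ ▸ smoothingParameter_pos hL hM hT⟩
    refine ⟨h.integrable_norm_gradient_sq, h.averageSqGradient_rate hT hL hM hC hκ hΔ hD hκη hη hδ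
      (b := fun _ => ε) hb rfl fun k => ?_⟩
    rw [hα k]
    calc _ ≤ C / ((k : ℝ) + 1) ^ (2 / 3 : ℝ) * ε ^ 2 := by gcongr; exact min_le_left _ _
      _ = _ := by ring
  · intro L M MΦ C ε θ κ Δ D hL hM hC hε _ _ hκ _
    refine ⟨rateConstant L M MΦ C ε κ Δ D, rateConstant_pos L M MΦ Δ D hC hκ, ?_⟩
    intro p q r T hp hT Ω m μ _ ℱ v H P c hP hex hΔ hD hκη hη hδ hα hb
    have h : IsClosedLoop μ ℱ v H P c L M MΦ :=
      ⟨hp, hP, hex, fun k => hα k ▸ min_div_rpow_mem_Icc hC _ k,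
        (mul_pos hκ (maxStep_pos hL hp hT)).trans_le hκη, hδ ▸ smoothingParameter_pos hL hM hT⟩
    refine ⟨h.integrable_norm_gradient_sq, h.averageSqGradient_rate hT hL hM hC hκ hΔ hD hκη hη hδ
      (b := fun k : ℕ => ε / ((k : ℝ) + 1) ^ θ) hb (by simp) fun k => ?_⟩
    have hk : (0 : ℝ) < k + 1 := by positivity
    rw [hα k]
    calc _ ≤ C / ((k : ℝ) + 1) ^ (2 / 3 - 2 * θ) * (ε / ((k : ℝ) + 1) ^ θ) ^ 2 := by
          gcongr
          exact min_le_left _ _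
      _ = C * ε ^ 2 * (1 / (((k : ℝ) + 1) ^ (2 / 3 - 2 * θ) * (((k : ℝ) + 1) ^ θ) ^ 2)) := by
          field_simp
      -- The exponents `2/3 - 2θ` and `2θ` add up to 2/3, so decaying errors lead to the same sum as
      -- bounded ones.
      _ = _ := by
          rw [← Real.rpow_mul_natCast hk.le, ← Real.rpow_add hk]
          congr 4
          push_cast
          ring
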